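/- **Definitions.** Let $G=(V,E)$ be a finite simple graph. In the *zero forcing process* each vertex is blue or white; a blue vertex $u$ with exactly one white neighbour $v$ may force $v$, which turns $v$ blue. A set $S\subseteq V$ is a *zero forcing set* if, starting with exactly the vertices of $S$ blue, repeated forcing turns all vertices blue. $Z(G)$ is the minimum size of a zero forcing set. A *path decomposition* of $G$ is a sequence of bags $X_1,\dots,X_k\subseteq V$ such that every vertex lies in some bag, both ends of every edge lie in a common bag, and $v\in X_i\cap X_j$ with $i\le s\le j$ implies $v\in X_s$. Its *width* is $\max_i |X_i|-1$. **Proposition.** There are a single algorithm and a constant $C$ such that the following holds. Let $G$ be a connected graph with $n\ge 1$ vertices and $m$ edges, given by adjacency lists, and let $X_1,\dots,X_k$ be a path decomposition of $G$, of width $w$, given by lists of the elements of its bags. On this input the algorithm halts and returns a zero forcing set $S$ of $G$ with $$|S|\le (w+1)\,Z(G).$$ Its running time is at most $C\bigl(nm+\sum_{i=1}^k(|X_i|+1)\bigr)$, where the sum is the length of the description of the path decomposition. If $n\ge 2$ and the decomposition has at most $4n$ bags, the running time is at most $C\,nm$. In particular $C$ does not depend on $w$. The running time is the number of steps of a random access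 machine with finitely many registers and arrays of natural numbers, whose instructions, each counted as one step, are: setting a register to a constant, copying a register, adding or subtracting $1$, reading or writing an array cell at the index held by a register, and testing two registers for $<$ or $=$ to control branches and loops. -/

import Mathlib

/-! ### Zero forcing -/

namespace ZeroForcing

variable {V : Type*} [DecidableEq V]

/-- One application of the colour change rule: from the blue set `B`, a blue vertex `u` forces its
unique white neighbour `v`, and `B'` is the resulting blue set. -/
def ForceStep (G : SimpleGraph V) (B B' : Finset V) : Prop :=
  ∃ u ∈ B, ∃ v, v ∉ B ∧ G.Adj u v ∧ (∀ x, G.Adj u x → x ∉ B → x = v) ∧ B' = insert v B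

/-- `S` is a zero forcing set: starting from the blue set `S`, the colour change rule can be
iterated until all vertices are blue. -/
def IsZeroForcingSet [Fintype V] (G : SimpleGraph V) (S : Finset V) : Prop :=
  Relation.ReflTransGen (ForceStep G) S Finset.univ

/-- The zero forcing number `Z(G)`: the minimum size of a zero forcing set.  (The set of sizes is
never empty, as the set of all vertices is a zero forcing set.) -/
noncomputable def zeroForcingNumber [Fintype V] (G : SimpleGraph V) : ℕ :=
  sInf {s : ℕ | ∃ S : Finset V, IsZeroForcingSet G S ∧ S.card = s}

/-- Path decompositions with `k` bags `X 0, …, X (k - 1)`. -/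
structure IsPathDecomposition (G : SimpleGraph V) {k : ℕ} (X : Fin k → Finset V) : Prop where
  /-- Every vertex is in a bag (for a connected graph with at least two vertices this follows from
  the next condition). -/
  vertex_mem : ∀ v, ∃ i, v ∈ X i
  edge_mem : ∀ u v, G.Adj u v → ∃ i, u ∈ X i ∧ v ∈ X i
  interval : ∀ v i s j, i ≤ s → s ≤ j → v ∈ X i → v ∈ X j → v ∈ X s

/-- The width of a sequence of bags: the maximum of `|X i| - 1`, as an integer. -/
def width {k : ℕ} (X : Fin k → Finset V) : ℤ :=
  ((Finset.univ.sup fun i => (X i).card : ℕ) : ℤ) - 1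

end ZeroForcing

/-! ### A random access machine

The memory consists of registers and of one-dimensional arrays, all holding natural numbers; a
program uses a fixed finite number of registers and arrays, independent of the input.  The only
arithmetic is adding or subtracting one, so that after `t` steps no cell holds more than `t` plus
the largest number in the input and the program: unit cost per instruction hides no arithmetic on
long numbers. -/

namespace RAM

/-- A memory state: the registers and the arrays. -/
structure State where
  reg : ℕ → ℕ
  arr : ℕ → ℕ → ℕ

/-- Write `v` into register `x`. -/
def State.setReg (s : State) (x v : ℕ) : State :=
  { s with reg := Function.update s.reg x v }

/-- Write `v` into cell `i` of array `a`. -/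
def State.setArr (s : State) (a i v : ℕ) : State :=
  { s with arr := Function.update s.arr a (Function.update (s.arr a) i v) }

/-- Tests on two registers. -/
inductive Cond where
  | lt (x y : ℕ)
  | eq (x y : ℕ)

def Cond.Holds (s : State) : Cond → Prop
  | .lt x y => s.reg x < s.reg y
  | .eq x y => s.reg x = s.reg y

/-- Programs. -/
inductive Program where
  /-- do nothing -/
  | skip
  /-- register `x` := the constant `c` -/
  | const (x c : ℕ)
  /-- register `x` := register `y` -/
  | copy (x y : ℕ)
  /-- register `x` := register `x` + 1 -/
  | inc (x : ℕ)
  /-- register `x` := register `x` - 1 (a register that holds 0 keeps 0) -/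
  | dec (x : ℕ)
  /-- register `x` := array `a` at the index held by register `i` -/
  | load (x a i : ℕ)
  /-- array `a` at the index held by register `i` := register `x` -/
  | store (a i x : ℕ)
  /-- first `p`, then `q` -/
  | seq (p q : Program)
  /-- `p` if the test succeeds, `q` otherwise -/
  | ite (b : Cond) (p q : Program)
  /-- repeat `p` as long as the test succeeds -/
  | loop (b : Cond) (p : Program)

/-- `Run p s t s'`: the program `p`, started in the memory state `s`, halts after exactly `t` steps
in the memory state `s'`.  Each elementary instruction and each evaluation of a test is one
step. -/
inductive Run : Program → State → ℕ → State → Prop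
  | skip (s) : Run .skip s 1 s
  | const (x c s) : Run (.const x c) s 1 (s.setReg x c)
  | copy (x y s) : Run (.copy x y) s 1 (s.setReg x (s.reg y))
  | inc (x s) : Run (.inc x) s 1 (s.setReg x (s.reg x + 1))
  | dec (x s) : Run (.dec x) s 1 (s.setReg x (s.reg x - 1))
  | load (x a i s) : Run (.load x a i) s 1 (s.setReg x (s.arr a (s.reg i)))
  | store (a i x s) : Run (.store a i x) s 1 (s.setArr a (s.reg i) (s.reg x))
  | seq {p q s s' s'' t t'} : Run p s t s' → Run q s' t' s'' → Run (.seq p q) s (t + t') s''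
  | ite_true {b p q s s' t} : b.Holds s → Run p s t s' → Run (.ite b p q) s (t + 1) s'
  | ite_false {b p q s s' t} : ¬ b.Holds s → Run q s t s' → Run (.ite b p q) s (t + 1) s'
  | loop_false {b p s} : ¬ b.Holds s → Run (.loop b p) s 1 s
  | loop_true {b p s s' s'' t t'} : b.Holds s → Run p s t s' → Run (.loop b p) s' t' s'' →
      Run (.loop b p) s (t + t' + 1) s''

/-- Offsets of a family of lists that is stored contiguously: list number `i` occupies the cells
from `offsets L i` up to, but excluding, `offsets L (i + 1)`.  The cells after the last offset
hold 0. -/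
def offsets {n r : ℕ} (L : Fin r → List (Fin n)) (i : ℕ) : ℕ :=
  if i ≤ r then (((List.ofFn L).take i).map List.length).sum else 0

/-- The concatenation of a family of lists, followed by cells that hold 0. -/
def entries {n r : ℕ} (L : Fin r → List (Fin n)) (j : ℕ) : ℕ :=
  ((List.ofFn L).flatten.map fun v => (v : ℕ)).getD j 0

/-- The input: a graph on `n` numbered vertices, as the list `N v` of the neighbours of each vertex
`v`, and `k` bags, as the list `B i` of the vertices in each bag.  Registers 0 and 1 hold `n` and
`k`; arrays 0 and 1 hold the offsets and the entries of the neighbour lists, arrays 2 and 3 those of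
the bags; the rest of the memory holds 0. -/
def input {n k : ℕ} (N : Fin n → List (Fin n)) (B : Fin k → List (Fin n)) : State where
  reg x := if x = 0 then n else if x = 1 then k else 0
  arr a := if a = 0 then offsets N else if a = 1 then entries N
    else if a = 2 then offsets B else if a = 3 then entries B else fun _ => 0

/-- The output `S` in a final state: register 2 holds the size of `S`, and the first cells of array
4, that many, list the elements of `S` without repetition. -/
def Outputs {n : ℕ} (s : State) (S : Finset (Fin n)) : Prop :=
  ∃ l : List (Fin n), l.Nodup ∧ l.toFinset = S ∧ s.reg 2 = l.length ∧
    (List.range l.length).map (s.arr 4) = l.map fun v => (v : ℕ)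

/-- The list `l` lists the elements of the set `A`, each exactly once, in any order. -/
def Lists {n : ℕ} (l : List (Fin n)) (A : Set (Fin n)) : Prop :=
  l.Nodup ∧ ∀ v, v ∈ l ↔ v ∈ A

end RAM

/-! The bags are read from left to right and the vertices are cut into segments. A new vertex joins
the current segment. When the current segment contains a fort, the segment ends at the bag just
read, and the next one starts with the vertices still unseen. Every zero forcing set meets every
fort, so the number `r` of completed segments is at most `Z(G)` (`le_zeroForcingNumber`). It remains
to find a zero forcing set with at most `w + 1` vertices per completed segment.

Let `U` consist of the vertices of each completed segment that lie in its last bag. A segment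
without these vertices was part of a white set without a fort, so it can be forced from its
complement. This gives each vertex `v` outside `U` a forcer `f v` and a time `τ v`. The forcer may
lie in `U` and have a smaller label. The arc from `f v` to `v` is dropped if the label of `f v` is
more than one smaller. The other arcs are used forward in segments with an even label and backward
in those with an odd label. The result is the set of vertices that no used arc enters.

Neighbouring segments have different parity, so an arc that reaches back by one label cannot
interfere with an arc of the same direction in another segment. Hence the backward arcs can all be
carried out, and then the forward arcs (`IsSegmentation.isZeroForcingSet`). The size is at most
`|U|` plus the number of dropped arcs. The part of `U` with label `t` and the dropped forcers of
segment `t + 1` are disjoint subsets of the last bag of segment `t`, which has at most `w + 1`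
vertices (`IsSegmentation.card_le`).

For the running time, simulating the forcing process from a given white set takes `O(n + m)` steps:
it either yields forcers or stops at a nonempty white set, which is a fort (`does_closure`). The
test is needed only at bags with new vertices, hence at most `n` times, and `n ≤ m + 1` by
connectedness. Registers and arrays are numbered with the long-lived data first, so that what a
subroutine preserves is mostly described by two bounds in `Frame`. -/

set_option linter.unusedSectionVars false

namespace ZeroForcing

/-! ### Forts, forcing times and the lower bound -/

section Combinatorics

variable {V : Type*} [DecidableEq V] {G : SimpleGraph V}

/-- A fort: a nonempty set such that no vertex outside has exactly one neighbour in it. -/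
def IsFort (G : SimpleGraph V) (F : Finset V) : Prop :=
  F.Nonempty ∧ ∀ u ∉ F, ¬ ∃ v ∈ F, G.Adj u v ∧ ∀ x ∈ F, G.Adj u x → x = v

/-- The white set `P` can be turned blue from its complement: `v ∈ P` is forced by `f v` at
time `τ v`. -/
def Forces (G : SimpleGraph V) (P : Finset V) (f : V → V) (τ : V → ℕ) : Prop :=
  ∀ v ∈ P, G.Adj (f v) v ∧ (f v ∈ P → τ (f v) < τ v) ∧
    ∀ x ∈ P, G.Adj (f v) x → x ≠ v → τ x < τ v

theorem Forces.mono {P Q : Finset V} {f : V → V} {τ : V → ℕ} (h : Forces G P f τ) (hQ : Q ⊆ P) :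
    Forces G Q f τ := fun v hv =>
  ⟨(h v (hQ hv)).1, fun hf => (h v (hQ hv)).2.1 (hQ hf), fun x hx => (h v (hQ hv)).2.2 x (hQ hx)⟩

theorem Forces.congr {P : Finset V} {f f' : V → V} {τ τ' : V → ℕ} (h : Forces G P f τ)
    (hf : ∀ v ∈ P, f' v = f v) (hτ : ∀ v ∈ P, τ' v = τ v) : Forces G P f' τ' := by
  intro v hv
  obtain ⟨h1, h2, h3⟩ := h v hv
  rw [hf v hv, hτ v hv]
  refine ⟨h1, fun h' => ?_, fun x hx hax hne => ?_⟩
  · rw [hτ _ h']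
    exact h2 h'
  · rw [hτ x hx]
    exact h3 x hx hax hne

/-- The earliest vertex of `F` to be forced has a forcer outside `F`, which sees no other vertex of
`F`. -/
theorem Forces.not_isFort {P F : Finset V} {f : V → V} {τ : V → ℕ} (h : Forces G P f τ)
    (hF : F ⊆ P) : ¬ IsFort G F := by
  rintro ⟨hne, hfort⟩
  obtain ⟨v, hv, hmin⟩ := F.exists_min_image τ hne
  obtain ⟨h1, h2, h3⟩ := h v (hF hv)
  refine hfort (f v) (fun hfv => ?_) ⟨v, hv, h1, fun x hx hax => ?_⟩
  · exact absurd (h2 (hF hfv)) (not_lt.2 (hmin _ hfv))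
  · by_contra hxv
    exact absurd (h3 x (hF hx) hax hxv) (not_lt.2 (hmin _ hx))

/-- The forcing process for the white set `P`, at a moment when `W` is still white. -/
def PartlyForces (G : SimpleGraph V) (P W : Finset V) (f : V → V) (τ : V → ℕ) : Prop :=
  W ⊆ P ∧ Forces G (P \ W) f τ ∧ ∀ v ∈ P \ W, f v ∉ W ∧ ∀ x ∈ W, ¬ G.Adj (f v) x

theorem partlyForces_self (P : Finset V) (f : V → V) (τ : V → ℕ) : PartlyForces G P P f τ := by
  simp [PartlyForces, Forces]

theorem PartlyForces.forces {P : Finset V} {f : V → V} {τ : V → ℕ}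
    (h : PartlyForces G P ∅ f τ) : Forces G P f τ := by
  simpa using h.2.1

/-- The new vertex gets a time above all existing values of `τ`. Earlier arcs are unaffected,
because their forcers are blue and have no white neighbours left; that is why `PartlyForces` records
this. -/
theorem PartlyForces.step [Fintype V] {P W : Finset V} {f : V → V} {τ : V → ℕ}
    (h : PartlyForces G P W f τ) {u v : V} (hu : u ∉ W) (hv : v ∈ W) (huv : G.Adj u v)
    (huniq : ∀ x ∈ W, G.Adj u x → x = v) :
    PartlyForces G P (W.erase v) (Function.update f v u)
      (Function.update τ v (Finset.univ.sup τ + 1)) := by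
  obtain ⟨hWP, hF, hW⟩ := h
  have hlt : ∀ x, τ x < Finset.univ.sup τ + 1 := fun x =>
    Nat.lt_succ_of_le (Finset.le_sup (Finset.mem_univ x))
  have huv' : u ≠ v := huv.ne
  refine ⟨(Finset.erase_subset _ _).trans hWP, ?_, ?_⟩
  · intro w hw
    by_cases hwv : w = v
    · subst hwv
      simp only [Function.update_self]
      refine ⟨huv, fun _ => ?_, fun x _ _ hxv => ?_⟩
      · rw [Function.update_of_ne huv']
        exact hlt _
      · rw [Function.update_of_ne hxv]
        exact hlt _
    · have hwP : w ∈ P \ W := by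
        simp only [Finset.mem_sdiff, Finset.mem_erase] at hw ⊢
        exact ⟨hw.1, fun h' => hw.2 ⟨hwv, h'⟩⟩
      obtain ⟨h1, h2, h3⟩ := hF w hwP
      obtain ⟨h4, h5⟩ := hW w hwP
      rw [Function.update_of_ne hwv, Function.update_of_ne hwv]
      refine ⟨h1, fun h' => ?_, fun x hx hax hxw => ?_⟩
      · have hne : f w ≠ v := fun e => h4 (e ▸ hv)
        rw [Function.update_of_ne hne]
        refine h2 ?_
        simp only [Finset.mem_sdiff, Finset.mem_erase] at h' ⊢
        exact ⟨h'.1, h4⟩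
      · have hne : x ≠ v := fun e => h5 v hv (e ▸ hax)
        rw [Function.update_of_ne hne]
        refine h3 x ?_ hax hxw
        simp only [Finset.mem_sdiff, Finset.mem_erase] at hx ⊢
        exact ⟨hx.1, fun h' => hx.2 ⟨hne, h'⟩⟩
  · intro w hw
    by_cases hwv : w = v
    · subst hwv
      simp only [Function.update_self]
      refine ⟨fun h' => hu (Finset.mem_of_mem_erase h'), fun x hx hax => ?_⟩
      exact (Finset.mem_erase.1 hx).1 (huniq x (Finset.mem_of_mem_erase hx) hax)
    · have hwP : w ∈ P \ W := by
        simp only [Finset.mem_sdiff, Finset.mem_erase] at hw ⊢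
        exact ⟨hw.1, fun h' => hw.2 ⟨hwv, h'⟩⟩
      obtain ⟨h4, h5⟩ := hW w hwP
      rw [Function.update_of_ne hwv]
      exact ⟨fun h' => h4 (Finset.mem_of_mem_erase h'),
        fun x hx => h5 x (Finset.mem_of_mem_erase hx)⟩

/-- While a fort is entirely white, no vertex outside it can force into it. -/
theorem IsFort.not_disjoint [Fintype V] {F S : Finset V} (hF : IsFort G F)
    (hS : IsZeroForcingSet G S) : ∃ v ∈ S, v ∈ F := by
  by_contra hcon
  push Not at hcon
  have key : ∀ B, Relation.ReflTransGen (ForceStep G) S B → ∀ v ∈ B, v ∉ F := by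
    intro B hB
    induction hB with
    | refl => exact hcon
    | tail _ hstep ih =>
      obtain ⟨u, hu, v, hv, huv, huniq, rfl⟩ := hstep
      intro x hx hxF
      rcases Finset.mem_insert.1 hx with rfl | hx
      · exact hF.2 u (ih u hu) ⟨x, hxF, huv, fun y hy hay => huniq y hay fun hyB => ih y hyB hy⟩
      · exact ih x hx hxF
  obtain ⟨v, hv⟩ := hF.1
  exact key _ hS v (Finset.mem_univ v) hv

theorem exists_isZeroForcingSet_card_eq [Fintype V] (G : SimpleGraph V) :
    ∃ S : Finset V, IsZeroForcingSet G S ∧ S.card = zeroForcingNumber G :=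
  Nat.sInf_mem (s := {s : ℕ | ∃ S : Finset V, IsZeroForcingSet G S ∧ S.card = s})
    ⟨_, Finset.univ, Relation.ReflTransGen.refl, rfl⟩

/-- Disjoint forts bound the zero forcing number from below. -/
theorem le_zeroForcingNumber [Fintype V] {r : ℕ} (lb : V → ℕ)
    (h : ∀ t, 1 ≤ t → t ≤ r → ∃ F, IsFort G F ∧ ∀ v ∈ F, lb v = t) :
    r ≤ zeroForcingNumber G := by
  obtain ⟨S, hS, hcard⟩ := exists_isZeroForcingSet_card_eq G
  rw [← hcard]
  -- The labels separate the forts, so the vertices of `S` that hit them are distinct.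
  have hsub : Finset.Icc 1 r ⊆ S.image lb := by
    intro t ht
    obtain ⟨ht1, ht2⟩ := Finset.mem_Icc.1 ht
    obtain ⟨F, hF, hlb⟩ := h t ht1 ht2
    obtain ⟨v, hvS, hvF⟩ := hF.not_disjoint hS
    exact Finset.mem_image.2 ⟨v, hvS, hlb v hvF⟩
  calc r = (Finset.Icc 1 r).card := by simp
    _ ≤ (S.image lb).card := Finset.card_le_card hsub
    _ ≤ S.card := Finset.card_image_le

/-- A set is zero forcing if `univ` is its only superset in which no force is possible. -/
theorem isZeroForcingSet_of_closed [Fintype V] {S : Finset V}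
    (h : ∀ B, S ⊆ B → (∀ u ∈ B, ∀ v ∉ B, G.Adj u v → ∃ x, G.Adj u x ∧ x ∉ B ∧ x ≠ v) →
      B = Finset.univ) : IsZeroForcingSet G S := by
  classical
  -- A largest reachable blue set admits no further force.
  obtain ⟨B, hB, hmax⟩ := Finset.exists_max_image
    (Finset.univ.filter fun B => Relation.ReflTransGen (ForceStep G) S B) Finset.card
    ⟨S, by simpa using Relation.ReflTransGen.refl⟩
  simp only [Finset.mem_filter, Finset.mem_univ, true_and] at hB hmax
  have hSB : S ⊆ B := by
    clear hmax
    induction hB with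
    | refl => exact Finset.Subset.refl _
    | tail _ hstep ih =>
      obtain ⟨u, hu, v, hv, huv, huniq, rfl⟩ := hstep
      exact ih.trans (Finset.subset_insert _ _)
  have := h B hSB fun u hu v hv huv => by
    by_contra hcon
    push Not at hcon
    have := hmax _ (hB.tail ⟨u, hu, v, hv, huv, hcon, rfl⟩)
    rw [Finset.card_insert_of_notMem hv] at this
    omega
  rw [IsZeroForcingSet, ← this]
  exact hB

/-! ### Segmentations and alternating chains -/

/-- The vertex `v` keeps its forcer in the alternating chain system of a segmentation. -/
def Keeps (U : Finset V) (lb : V → ℕ) (f : V → V) (v : V) : Prop :=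
  v ∉ U ∧ lb v ≤ lb (f v) + 1

/-- The vertices that are not the start of a chain: in segments with an even label chains run
forward, in segments with an odd label they run backward. -/
def NotSource (U : Finset V) (lb : V → ℕ) (f : V → V) (x : V) : Prop :=
  ∃ v, Keeps U lb f v ∧ x = if lb v % 2 = 0 then v else f v

/-- A segmentation: outside the separating set `U`, neighbours have equal labels, and every
segment can be forced from its complement. -/
structure IsSegmentation (G : SimpleGraph V) [Fintype V] (U : Finset V) (lb : V → ℕ) (f : V → V)
    (τ : V → ℕ) : Prop where
  eq : ∀ v ∉ U, ∀ u ∉ U, G.Adj u v → lb u = lb v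
  le : ∀ v ∉ U, ∀ u, G.Adj u v → lb u ≤ lb v
  forces : ∀ t, Forces G (Finset.univ.filter fun v => v ∉ U ∧ lb v = t) f τ

namespace IsSegmentation

variable [Fintype V] {U : Finset V} {lb : V → ℕ} {f : V → V} {τ : V → ℕ}

theorem adj (h : IsSegmentation G U lb f τ) {v : V} (hv : v ∉ U) : G.Adj (f v) v :=
  (h.forces (lb v) v (by simp [hv])).1

theorem lt_self (h : IsSegmentation G U lb f τ) {v : V} (hv : v ∉ U) (hf : f v ∉ U) :
    τ (f v) < τ v :=
  (h.forces (lb v) v (by simp [hv])).2.1 (by simp [hf, h.eq v hv (f v) hf (h.adj hv)])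

theorem lt (h : IsSegmentation G U lb f τ) {v x : V} (hv : v ∉ U) (hx : x ∉ U) (hlb : lb x = lb v)
    (hadj : G.Adj (f v) x) (hne : x ≠ v) : τ x < τ v :=
  (h.forces (lb v) v (by simp [hv])).2.2 x (by simp [hx, hlb]) hadj hne

theorem injOn (h : IsSegmentation G U lb f τ) {v w : V} (hv : v ∉ U) (hw : w ∉ U)
    (hlb : lb v = lb w) (hvw : f v = f w) : v = w := by
  by_contra hne
  have h1 := h.lt hv hw hlb.symm (hvw ▸ h.adj hw) (Ne.symm hne)
  have h2 := h.lt hw hv hlb (hvw ▸ h.adj hv) hne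
  omega

/-- Both labels are the label of the common forcer or one more, and their parities agree. -/
theorem label_eq (h : IsSegmentation G U lb f τ) {v w : V} (hv : Keeps U lb f v)
    (hw : Keeps U lb f w) (hpar : lb v % 2 = lb w % 2) (hvw : f v = f w) : lb v = lb w := by
  have h1 := h.le v hv.1 _ (h.adj hv.1)
  have h2 := h.le w hw.1 _ (h.adj hw.1)
  have h3 := hv.2
  have h4 := hw.2
  rw [hvw] at h1 h3
  omega

/-- In a closed superset `B` of the sources, every white vertex is entered by a kept arc. Extremal
choices of an arc exclude first the backward arcs and then the forward ones. -/
theorem isZeroForcingSet (h : IsSegmentation G U lb f τ) {S : Finset V}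
    (hS : ∀ x, ¬ NotSource U lb f x → x ∈ S) : IsZeroForcingSet G S := by
  classical
  refine isZeroForcingSet_of_closed fun B hSB hB => ?_
  have hN : ∀ x ∉ B, ∃ v, Keeps U lb f v ∧ x = if lb v % 2 = 0 then v else f v := by
    intro x hx
    by_contra hcon
    exact hx (hSB (hS x hcon))
  -- no tail of a backward arc is white
  have hodd : ∀ v, Keeps U lb f v → lb v % 2 = 1 → f v ∈ B := by
    by_contra hcon
    push Not at hcon
    set M := Finset.univ.filter fun v => Keeps U lb f v ∧ lb v % 2 = 1 ∧ f v ∉ B with hM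
    have hMne : M.Nonempty := by
      obtain ⟨v, h1, h2, h3⟩ := hcon
      exact ⟨v, by simp [hM, h1, h2, h3]⟩
    -- Backward arcs are carried out by increasing label and, within a label, by decreasing time;
    -- `v` belongs to the first arc that fails.
    obtain ⟨v₀, hv₀, hmin₀⟩ := M.exists_min_image lb hMne
    obtain ⟨v, hv, hmax⟩ := (M.filter fun v => lb v = lb v₀).exists_max_image τ ⟨v₀, by simp [hv₀]⟩
    simp only [hM, Finset.mem_filter, Finset.mem_univ, true_and] at hv hmax hmin₀
    obtain ⟨⟨hvK, hvo, hvB⟩, hlb⟩ := hv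
    rw [← hlb] at hmin₀ hmax
    clear hv₀ hlb
    have hwhite : ∀ y ∉ B, (y ∈ U ∨ lb y = lb v) →
        ∃ w, Keeps U lb f w ∧ lb w % 2 = 1 ∧ y = f w ∧ lb v ≤ lb w := by
      intro y hyB hy
      obtain ⟨w, hwK, hw⟩ := hN y hyB
      have hwo : lb w % 2 = 1 := by
        by_contra hne
        have hwe : lb w % 2 = 0 := by omega
        rw [if_pos hwe] at hw
        subst hw
        rcases hy with hy | hy
        · exact hwK.1 hy
        · omega
      rw [if_neg (by omega)] at hw
      exact ⟨w, hwK, hwo, hw, hmin₀ w ⟨hwK, hwo, hw ▸ hyB⟩⟩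
    have hvB' : v ∈ B := by
      by_contra hvB'
      obtain ⟨w, hwK, hwo, hw, hle⟩ := hwhite v hvB' (Or.inr rfl)
      have hww : f w ∉ U := hw ▸ hvK.1
      have h1 := h.eq w hwK.1 (f w) hww (h.adj hwK.1)
      have h2 := hmax w ⟨⟨hwK, hwo, hw ▸ hvB'⟩, by rw [← h1, ← hw]⟩
      have h3 := h.lt_self hwK.1 hww
      rw [← hw] at h3
      omega
    -- A second white neighbour `y` of `v` would be entered by a backward arc from some `w`. Its
    -- label is at least `lb v` and at most `lb v + 1`, hence equal by parity, and `τ v < τ w`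
    -- contradicts the choice of `v`.
    obtain ⟨y, hy, hyB, hne⟩ := hB v hvB' (f v) hvB (h.adj hvK.1).symm
    obtain ⟨w, hwK, hwo, hw, hle⟩ := hwhite y hyB (by
      by_cases hyU : y ∈ U
      · exact Or.inl hyU
      · exact Or.inr (h.eq v hvK.1 y hyU hy.symm))
    have hwv : v ≠ w := fun e => hne (by rw [hw, e])
    have h1 := h.le v hvK.1 y hy.symm
    have h2 := hwK.2
    rw [← hw] at h2
    have hlb : lb v = lb w := by omega
    have h3 := h.lt hwK.1 hvK.1 hlb (hw ▸ hy.symm) hwv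
    have h4 := hmax w ⟨⟨hwK, hwo, hw ▸ hyB⟩, hlb.symm⟩
    omega
  have hwhite : ∀ y ∉ B, Keeps U lb f y ∧ lb y % 2 = 0 := by
    intro y hy
    obtain ⟨w, hwK, hw⟩ := hN y hy
    by_cases hpar : lb w % 2 = 0
    · rw [if_pos hpar] at hw
      subst hw
      exact ⟨hwK, hpar⟩
    · rw [if_neg hpar] at hw
      exact absurd (hodd w hwK (by omega)) (hw ▸ hy)
  by_contra hcon
  have hMne : (Finset.univ \ B).Nonempty := by
    rw [Finset.sdiff_nonempty]
    exact fun h' => hcon (Finset.univ_subset_iff.1 h')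
  -- Forward arcs are carried out in the opposite order: by decreasing label and, within a label, by
  -- increasing time.
  obtain ⟨v₀, hv₀, hmax₀⟩ := (Finset.univ \ B).exists_max_image lb hMne
  obtain ⟨v, hv, hmin⟩ := ((Finset.univ \ B).filter fun v => lb v = lb v₀).exists_min_image τ
    ⟨v₀, Finset.mem_filter.2 ⟨hv₀, rfl⟩⟩
  simp only [Finset.mem_filter, Finset.mem_sdiff, Finset.mem_univ, true_and] at hv hmin hmax₀
  obtain ⟨hvB, hlb⟩ := hv
  rw [← hlb] at hmin hmax₀
  clear hv₀ hlb
  obtain ⟨hvK, hve⟩ := hwhite v hvB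
  have hfB : f v ∈ B := by
    by_contra hfB
    have hfU := (hwhite _ hfB).1.1
    have h1 := h.lt_self hvK.1 hfU
    have h2 := hmin _ ⟨hfB, h.eq v hvK.1 _ hfU (h.adj hvK.1)⟩
    omega
  obtain ⟨y, hy, hyB, hne⟩ := hB (f v) hfB v hvB (h.adj hvK.1)
  obtain ⟨hyK, hye⟩ := hwhite y hyB
  have h1 := hmax₀ y hyB
  have h2 := h.le y hyK.1 _ hy
  have h3 := hvK.2
  have hlb : lb y = lb v := by omega
  have h4 := h.lt hvK.1 hyK.1 hlb hy hne
  have h5 := hmin y ⟨hyB, hlb⟩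
  omega

/-- Each kept arc enters a different vertex, so the sources number at most `|U|` plus the number of
dropped arcs `|D|`. Both are counted by the separator `Y t` to which they are charged. -/
theorem card_le (h : IsSegmentation G U lb f τ) {S : Finset V} {r w : ℕ}
    (hS : ∀ x ∈ S, ¬ NotSource U lb f x) (hpos : ∀ v, 1 ≤ lb v) (hle : ∀ v, lb v ≤ r + 1)
    (hU : ∀ v ∈ U, lb v ≤ r) (Y : ℕ → Finset V) (hY : ∀ t, (Y t).card ≤ w)
    (hUY : ∀ v ∈ U, v ∈ Y (lb v))
    (hold : ∀ u ∈ U, ∀ v ∉ U, G.Adj u v → lb u + 1 < lb v → u ∈ Y (lb v - 1)) :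
    S.card ≤ r * w := by
  classical
  set K := Finset.univ.filter fun v => Keeps U lb f v with hK
  set D := Finset.univ.filter fun v => v ∉ U ∧ ¬ Keeps U lb f v with hD
  set g : V → V := fun v => if lb v % 2 = 0 then v else f v with hg
  have hginj : Set.InjOn g K := by
    intro v hv v' hv' hvv'
    simp only [hK, Finset.coe_filter, Finset.mem_univ, true_and, Set.mem_ofPred_eq] at hv hv'
    -- A forward and a backward arc entering the same vertex would have that vertex outside `U`,
    -- hence equal labels, against their parities.
    have hmix : ∀ a b, Keeps U lb f a → Keeps U lb f b → lb a % 2 = 0 → ¬ lb b % 2 = 0 →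
        a ≠ f b := by
      intro a b ha hb ha0 hb0 hab
      have := h.eq b hb.1 (f b) (hab ▸ ha.1) (h.adj hb.1)
      rw [← hab] at this
      omega
    simp only [hg] at hvv'
    split_ifs at hvv' with h1 h2 h2
    · exact hvv'
    · exact absurd hvv' (hmix v v' hv hv' h1 h2)
    · exact absurd hvv'.symm (hmix v' v hv' hv h2 h1)
    · exact h.injOn hv.1 hv'.1 (h.label_eq hv hv' (by omega) hvv') hvv'
  have h1 : S.card + K.card ≤ Fintype.card V := by
    rw [← Finset.card_image_of_injOn hginj, ← Finset.card_union_of_disjoint]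
    · exact Finset.card_le_univ _
    · rw [Finset.disjoint_left]
      intro x hx hx'
      obtain ⟨v, hv, rfl⟩ := Finset.mem_image.1 hx'
      exact hS _ hx ⟨v, by simpa [hK] using hv, rfl⟩
  have h2 : Fintype.card V ≤ U.card + K.card + D.card := by
    have : (Finset.univ : Finset V) ⊆ U ∪ K ∪ D := by
      intro v _
      simp only [hK, hD, Finset.mem_union, Finset.mem_filter, Finset.mem_univ, true_and]
      tauto
    calc Fintype.card V = (Finset.univ : Finset V).card := rfl
      _ ≤ (U ∪ K ∪ D).card := Finset.card_le_card this
      _ ≤ _ := (Finset.card_union_le _ _).trans (Nat.add_le_add_right (Finset.card_union_le _ _) _)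
  have hDU : ∀ v ∈ D, f v ∈ U ∧ lb (f v) + 1 < lb v := by
    intro v hv
    simp only [hD, Finset.mem_filter, Finset.mem_univ, true_and] at hv
    have hlt : lb (f v) + 1 < lb v := by
      by_contra hcon
      exact hv.2 ⟨hv.1, by omega⟩
    refine ⟨?_, hlt⟩
    by_contra hfU
    have := h.eq v hv.1 _ hfU (h.adj hv.1)
    omega
  have hU' : U.card = ∑ t ∈ Finset.Icc 1 r, (U.filter fun v => lb v = t).card :=
    Finset.card_eq_sum_card_fiberwise fun v hv => by
      simpa using ⟨hpos v, hU v hv⟩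
  have hD' : D.card = ∑ t ∈ Finset.Icc 1 r, (D.filter fun v => lb v - 1 = t).card :=
    Finset.card_eq_sum_card_fiberwise fun v hv => by
      have := hDU v hv
      have := hle v
      simp only [Finset.coe_Icc, Set.mem_Icc]
      omega
  -- Dropped arcs of segment `t + 1` have distinct forcers, all with label below `t`; so these
  -- differ from the vertices of `U` with label `t`, and both kinds lie in `Y t`.
  have hsum : ∀ t ∈ Finset.Icc 1 r, (U.filter fun v => lb v = t).card +
      (D.filter fun v => lb v - 1 = t).card ≤ w := by
    intro t ht
    have hinj : Set.InjOn f (D.filter fun v => lb v - 1 = t) := by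
      intro v hv v' hv' hvv'
      simp only [Finset.coe_filter, Set.mem_ofPred_eq] at hv hv'
      have e1 := hDU v hv.1
      have e2 := hDU v' hv'.1
      refine h.injOn (Finset.mem_filter.1 hv.1).2.1 (Finset.mem_filter.1 hv'.1).2.1 ?_ hvv'
      omega
    rw [← Finset.card_image_of_injOn hinj, ← Finset.card_union_of_disjoint]
    · refine (Finset.card_le_card ?_).trans (hY t)
      intro x hx
      rcases Finset.mem_union.1 hx with hx | hx
      · obtain ⟨hxU, hlb⟩ := Finset.mem_filter.1 hx
        exact hlb ▸ hUY x hxU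
      · obtain ⟨v, hv, rfl⟩ := Finset.mem_image.1 hx
        obtain ⟨hvD, hlb⟩ := Finset.mem_filter.1 hv
        obtain ⟨e1, e2⟩ := hDU v hvD
        have hvU := (Finset.mem_filter.1 hvD).2.1
        exact hlb ▸ hold _ e1 v hvU (h.adj hvU) e2
    · rw [Finset.disjoint_left]
      intro x hx hx'
      obtain ⟨v, hv, rfl⟩ := Finset.mem_image.1 hx'
      obtain ⟨hv, e⟩ := Finset.mem_filter.1 hv
      have e1 := (hDU v hv).2
      have e2 := (Finset.mem_filter.1 hx).2
      omega
  have h3 : U.card + D.card ≤ r * w := by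
    rw [hU', hD', ← Finset.sum_add_distrib]
    refine (Finset.sum_le_card_nsmul _ _ w hsum).trans ?_
    simp
  omega

end IsSegmentation

/-! ### The greedy segmentation along a path decomposition -/

/-- Path decompositions as sequences of bags indexed by `ℕ`. -/
structure IsPathSequence (G : SimpleGraph V) (X : ℕ → Finset V) : Prop where
  edge_mem : ∀ u v, G.Adj u v → ∃ i, u ∈ X i ∧ v ∈ X i
  interval : ∀ v i s j, i ≤ s → s ≤ j → v ∈ X i → v ∈ X j → v ∈ X s

/-- The state of the greedy segmentation after the bags before `j` are read: the segments
`1, …, s` are complete and end at the bags `b 1, …, b s`. -/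
structure Progress [Fintype V] (G : SimpleGraph V) (X : ℕ → Finset V) (j s : ℕ) (lb : V → ℕ)
    (b : ℕ → ℕ) (f : V → V) (τ : V → ℕ) : Prop where
  seen : ∀ v, lb v ≠ 0 ↔ ∃ i < j, v ∈ X i
  le : ∀ v, lb v ≤ s + 1
  cut : ∀ t v, 1 ≤ t → t ≤ s → (lb v ≠ 0 ∧ lb v ≤ t ↔ ∃ i ≤ b t, v ∈ X i)
  fort : ∀ t, 1 ≤ t → t ≤ s → ∃ F, IsFort G F ∧ ∀ v ∈ F, lb v = t
  forces : ∀ t, 1 ≤ t → t ≤ s →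
    Forces G (Finset.univ.filter fun v => lb v = t ∧ v ∉ X (b t)) f τ
  last : ∃ f τ, Forces G (Finset.univ.filter fun v => lb v = s + 1) f τ

/-- The labels after bag `j` is read. -/
def relabel (X : ℕ → Finset V) (j s : ℕ) (lb : V → ℕ) (v : V) : ℕ :=
  if lb v = 0 ∧ v ∈ X j then s + 1 else lb v

/-- The vertices that are not sources, as far as the segments `1, …, s` decide it. -/
def NotSourceUpTo (X : ℕ → Finset V) (s : ℕ) (lb : V → ℕ) (b : ℕ → ℕ) (f : V → V) (x : V) : Prop :=
  ∃ v, lb v ≠ 0 ∧ lb v ≤ s ∧ v ∉ X (b (lb v)) ∧ lb v ≤ lb (f v) + 1 ∧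
    x = if lb v % 2 = 0 then v else f v

namespace Progress

variable [Fintype V] {X : ℕ → Finset V} {j s : ℕ} {lb : V → ℕ} {b : ℕ → ℕ} {f : V → V} {τ : V → ℕ}

theorem zero (G : SimpleGraph V) (X : ℕ → Finset V) (b : ℕ → ℕ) (f : V → V) (τ : V → ℕ) :
    Progress G X 0 0 (fun _ => 0) b f τ where
  seen := by simp
  le := by simp
  cut := by intros; omega
  fort := by intros; omega
  forces := by intros; omega
  last := ⟨f, τ, by simp [Forces]⟩

theorem seen_relabel (h : Progress G X j s lb b f τ) (v : V) :
    relabel X j s lb v ≠ 0 ↔ ∃ i < j + 1, v ∈ X i := by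
  have h1 := h.seen v
  unfold relabel
  constructor
  · intro h2
    split_ifs at h2 with h3
    · exact ⟨j, by omega, h3.2⟩
    · obtain ⟨i, hi, hv⟩ := h1.1 h2
      exact ⟨i, by omega, hv⟩
  · rintro ⟨i, hi, hv⟩
    split_ifs with h3
    · omega
    · intro h4
      rcases Nat.lt_succ_iff_lt_or_eq.1 hi with hi | rfl
      · exact h1.2 ⟨i, hi, hv⟩ h4
      · exact h3 ⟨h4, hv⟩

theorem relabel_le_iff {t : ℕ} (ht : t ≤ s) (v : V) :
    relabel X j s lb v ≠ 0 ∧ relabel X j s lb v ≤ t ↔ lb v ≠ 0 ∧ lb v ≤ t := by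
  unfold relabel
  split_ifs with h
  · omega
  · rfl

theorem relabel_eq_iff {t : ℕ} (ht : 1 ≤ t) (ht' : t ≤ s) (v : V) :
    relabel X j s lb v = t ↔ lb v = t := by
  unfold relabel
  split_ifs with h
  · omega
  · rfl

/-- No boundary at bag `j`. -/
theorem extend (h : Progress G X j s lb b f τ)
    (hlast : ∃ f τ, Forces G (Finset.univ.filter fun v => relabel X j s lb v = s + 1) f τ) :
    Progress G X (j + 1) s (relabel X j s lb) b f τ where
  seen := h.seen_relabel
  le v := by
    have := h.le v
    unfold relabel
    split_ifs <;> omega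
  cut t v ht ht' := by rw [relabel_le_iff ht', h.cut t v ht ht']
  fort t ht ht' := by
    obtain ⟨F, hF, hF'⟩ := h.fort t ht ht'
    exact ⟨F, hF, fun v hv => (relabel_eq_iff ht ht' v).2 (hF' v hv)⟩
  forces t ht ht' := by
    simp only [relabel_eq_iff ht ht']
    exact h.forces t ht ht'
  last := hlast

/-- Removing the last bag undoes every addition made at it. What remains was in the segment before
that bag, when it still contained no fort. -/
theorem current_subset (X : ℕ → Finset V) (j s : ℕ) (lb : V → ℕ) :
    (Finset.univ.filter fun v => relabel X j s lb v = s + 1 ∧ v ∉ X j) ⊆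
      Finset.univ.filter fun v => lb v = s + 1 := by
  intro v hv
  simp only [Finset.mem_filter, Finset.mem_univ, true_and] at hv ⊢
  obtain ⟨h1, h2⟩ := hv
  unfold relabel at h1
  rwa [if_neg (fun h => h2 h.2)] at h1

/-- Segment `s + 1` ends at bag `j`. -/
theorem close (h : Progress G X j s lb b f τ) {P : Finset V}
    (hP : P = Finset.univ.filter fun v => relabel X j s lb v = s + 1 ∧ v ∉ X j)
    {F : Finset V} (hF : IsFort G F) (hF' : ∀ v ∈ F, relabel X j s lb v = s + 1)
    {f' : V → V} {τ' : V → ℕ} (hf : Forces G P f' τ') :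
    Progress G X (j + 1) (s + 1) (relabel X j s lb) (Function.update b (s + 1) j)
      (fun v => if v ∈ P then f' v else f v) (fun v => if v ∈ P then τ' v else τ v) where
  seen := h.seen_relabel
  le v := by
    have := h.le v
    unfold relabel
    split_ifs <;> omega
  cut t v ht ht' := by
    by_cases hts : t = s + 1
    · subst hts
      rw [Function.update_self]
      have h1 := h.seen_relabel v
      simp only [Nat.lt_succ_iff] at h1
      rw [← h1]
      have : relabel X j s lb v ≤ s + 1 := by
        have := h.le v
        unfold relabel
        split_ifs <;> omega
      simp [this]
    · rw [Function.update_of_ne hts, relabel_le_iff (by omega), h.cut t v ht (by omega)]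
  fort t ht ht' := by
    by_cases hts : t = s + 1
    · subst hts
      exact ⟨F, hF, hF'⟩
    · obtain ⟨F, hF, hF'⟩ := h.fort t ht (by omega)
      exact ⟨F, hF, fun v hv => (relabel_eq_iff ht (by omega) v).2 (hF' v hv)⟩
  forces t ht ht' := by
    by_cases hts : t = s + 1
    · subst hts
      rw [Function.update_self, ← hP]
      exact hf.congr (fun v hv => if_pos hv) (fun v hv => if_pos hv)
    · rw [Function.update_of_ne hts]
      simp only [relabel_eq_iff ht (show t ≤ s by omega)]
      have hnot : ∀ v ∈ Finset.univ.filter (fun v => lb v = t ∧ v ∉ X (b t)), v ∉ P := by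
        intro v hv hvP
        simp only [hP, Finset.mem_filter, Finset.mem_univ, true_and] at hv hvP
        have := (relabel_eq_iff (X := X) (j := j) ht (show t ≤ s by omega) v).2 hv.1
        omega
      exact (h.forces t ht (by omega)).congr (fun v hv => if_neg (hnot v hv))
        (fun v hv => if_neg (hnot v hv))
  last := by
    refine ⟨f, τ, ?_⟩
    have : (Finset.univ.filter fun v => relabel X j s lb v = s + 1 + 1) = ∅ := by
      rw [Finset.filter_eq_empty_iff]
      intro v _
      have := h.le v
      unfold relabel
      split_ifs <;> omega
    rw [this]
    simp [Forces]

/-- All bags of `v` precede the last bag of its segment, so its neighbours have been read by then.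
Whether the arc into `v` is kept is therefore final when the segment ends. -/
theorem label_forcer_ne_zero (h : Progress G X j s lb b f τ) (hX : IsPathSequence G X) {v : V}
    (h0 : lb v ≠ 0) (hs : lb v ≤ s) (hv : v ∉ X (b (lb v))) : lb (f v) ≠ 0 := by
  have hpos : 1 ≤ lb v := Nat.one_le_iff_ne_zero.2 h0
  have hadj := (h.forces (lb v) hpos hs v (by simp [hv])).1
  obtain ⟨i, hi, hvi⟩ := (h.cut (lb v) v hpos hs).1 ⟨h0, le_rfl⟩
  obtain ⟨i', hfi, hvi'⟩ := hX.edge_mem _ _ hadj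
  refine ((h.cut (lb v) (f v) hpos hs).2 ⟨i', ?_, hfi⟩).1
  by_contra hcon
  exact hv (hX.interval v i _ i' hi (by omega) hvi hvi')

theorem notSourceUpTo_relabel (h : Progress G X j s lb b f τ) (hX : IsPathSequence G X) (x : V) :
    NotSourceUpTo X s (relabel X j s lb) b f x ↔ NotSourceUpTo X s lb b f x := by
  constructor
  · rintro ⟨v, h0, hle, hv, hk, hx⟩
    have hlb : relabel X j s lb v = lb v := by
      unfold relabel at hle ⊢
      split_ifs at hle ⊢
      · omega
      · rfl
    rw [hlb] at h0 hle hv hk hx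
    have hf := h.label_forcer_ne_zero hX h0 hle hv
    rw [relabel, if_neg (fun h => hf h.1)] at hk
    exact ⟨v, h0, hle, hv, hk, hx⟩
  · rintro ⟨v, h0, hle, hv, hk, hx⟩
    have hlb : relabel X j s lb v = lb v := by
      rw [relabel, if_neg (fun h => h0 h.1)]
    have hf := h.label_forcer_ne_zero hX h0 hle hv
    refine ⟨v, ?_⟩
    rw [hlb, relabel, if_neg (fun h => hf h.1)]
    exact ⟨h0, hle, hv, hk, hx⟩

theorem notSourceUpTo_close (h : Progress G X j s lb b f τ) (hX : IsPathSequence G X)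
    {P : Finset V} (hP : P = Finset.univ.filter fun v => relabel X j s lb v = s + 1 ∧ v ∉ X j)
    (f' : V → V) (x : V) :
    NotSourceUpTo X (s + 1) (relabel X j s lb) (Function.update b (s + 1) j)
      (fun v => if v ∈ P then f' v else f v) x ↔
    NotSourceUpTo X s lb b f x ∨ ∃ v ∈ P, s + 1 ≤ relabel X j s lb (f' v) + 1 ∧
      x = if (s + 1) % 2 = 0 then v else f' v := by
  constructor
  · rintro ⟨v, h0, hle, hv, hk, hx⟩
    by_cases hs : relabel X j s lb v = s + 1
    · rw [hs, Function.update_self] at hv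
      have hvP : v ∈ P := by simp [hP, hs, hv]
      rw [hs] at hk hx
      simp only [if_pos hvP] at hk hx
      exact Or.inr ⟨v, hvP, hk, hx⟩
    · have hlb : relabel X j s lb v = lb v := by
        unfold relabel at hs ⊢
        split_ifs at hs ⊢
        · omega
        · rfl
      have hvP : v ∉ P := by simp [hP, hs]
      rw [hlb] at h0 hle hv hk hx hs
      simp only [if_neg hvP] at hk hx
      rw [Function.update_of_ne hs] at hv
      have hf := h.label_forcer_ne_zero hX h0 (by omega) hv
      rw [relabel, if_neg (fun h => hf h.1)] at hk
      exact Or.inl ⟨v, h0, by omega, hv, hk, hx⟩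
  · rintro (⟨v, h0, hle, hv, hk, hx⟩ | ⟨v, hvP, hk, hx⟩)
    · have hlb : relabel X j s lb v = lb v := by
        rw [relabel, if_neg (fun h => h0 h.1)]
      have hs : lb v ≠ s + 1 := by omega
      have hvP : v ∉ P := by simp [hP, hlb, hs]
      have hf := h.label_forcer_ne_zero hX h0 hle hv
      refine ⟨v, ?_⟩
      simp only [hlb, if_neg hvP]
      rw [Function.update_of_ne hs, relabel, if_neg (fun h => hf h.1)]
      exact ⟨h0, by omega, hv, hk, hx⟩
    · have hvP' := hvP
      simp only [hP, Finset.mem_filter, Finset.mem_univ, true_and] at hvP'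
      refine ⟨v, ?_⟩
      simp only [hvP'.1, if_pos hvP]
      rw [Function.update_self]
      exact ⟨by omega, le_rfl, hvP'.2, hk, hx⟩

/-- The outcome of the greedy segmentation. -/
theorem isZeroForcingSet_and_card_le (h : Progress G X j s lb b f τ) (hX : IsPathSequence G X)
    (hall : ∀ v, lb v ≠ 0) {P : Finset V} (hP : P = Finset.univ.filter fun v => lb v = s + 1)
    {f' : V → V} {τ' : V → ℕ} (hf : Forces G P f' τ') {S : Finset V} (hS : ∀ x, x ∈ S ↔
      ¬ (NotSourceUpTo X s lb b f x ∨ ∃ v ∈ P, s + 1 ≤ lb (f' v) + 1 ∧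
        x = if (s + 1) % 2 = 0 then v else f' v)) {w : ℕ} (hw : ∀ i, (X i).card ≤ w) :
    IsZeroForcingSet G S ∧ S.card ≤ w * zeroForcingNumber G := by
  set U := Finset.univ.filter fun v => lb v ≤ s ∧ v ∈ X (b (lb v)) with hU
  set g : V → V := fun v => if v ∈ P then f' v else f v with hg
  have hpos : ∀ v, 1 ≤ lb v := fun v => Nat.one_le_iff_ne_zero.2 (hall v)
  have hcut : ∀ t v, 1 ≤ t → t ≤ s → (lb v ≤ t ↔ ∃ i ≤ b t, v ∈ X i) := fun t v ht hts => by
    rw [← h.cut t v ht hts]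
    simp [hall v]
  have hUmem : ∀ v, v ∈ U ↔ lb v ≤ s ∧ v ∈ X (b (lb v)) := by simp [hU]
  have hPmem : ∀ v, v ∈ P ↔ lb v = s + 1 := by simp [hP]
  have hle : ∀ v ∉ U, ∀ u, G.Adj u v → lb u ≤ lb v := by
    -- Since `v` is not in the last bag of its segment, it has no bag from there on, and `u` shares
    -- a bag with it. In the unfinished segment the label is maximal anyway.
    intro v hv u huv
    obtain ⟨i, hui, hvi⟩ := hX.edge_mem u v huv
    by_cases hs : lb v ≤ s
    · refine (hcut _ u (hpos v) hs).2 ⟨i, ?_, hui⟩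
      obtain ⟨i', hi', hvi'⟩ := (hcut _ v (hpos v) hs).1 le_rfl
      by_contra hcon
      exact hv ((hUmem v).2 ⟨hs, hX.interval v i' _ i hi' (by omega) hvi' hvi⟩)
    · have := h.le u
      omega
  have hseg : IsSegmentation G U lb g (fun v => if v ∈ P then τ' v else τ v) := by
    refine ⟨fun v hv u hu huv => le_antisymm (hle v hv u huv) (hle u hu v huv.symm), hle, ?_⟩
    intro t
    by_cases ht : t ≤ s
    · by_cases ht0 : 1 ≤ t
      · have hmem : ∀ v, v ∉ U ∧ lb v = t ↔ lb v = t ∧ v ∉ X (b t) := by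
          intro v
          rw [hUmem]
          constructor
          · rintro ⟨h1, rfl⟩
            exact ⟨rfl, fun h2 => h1 ⟨ht, h2⟩⟩
          · rintro ⟨rfl, h1⟩
            exact ⟨fun h2 => h1 h2.2, rfl⟩
        simp only [hmem]
        have hnot : ∀ v ∈ Finset.univ.filter (fun v => lb v = t ∧ v ∉ X (b t)), v ∉ P := by
          intro v hv hvP
          rw [hPmem] at hvP
          have := (Finset.mem_filter.1 hv).2.1
          omega
        exact (h.forces t ht0 ht).congr (fun v hv => if_neg (hnot v hv))
          (fun v hv => if_neg (hnot v hv))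
      · intro v hv
        have := (Finset.mem_filter.1 hv).2.2
        have := hpos v
        omega
    · have hsub : (Finset.univ.filter fun v => v ∉ U ∧ lb v = t) ⊆ P := by
        intro v hv
        have := (Finset.mem_filter.1 hv).2.2
        have := h.le v
        rw [hPmem]
        omega
      exact (hf.mono hsub).congr (fun v hv => if_pos (hsub hv)) (fun v hv => if_pos (hsub hv))
  have hNS : ∀ x, NotSource U lb g x ↔ (NotSourceUpTo X s lb b f x ∨
      ∃ v ∈ P, s + 1 ≤ lb (f' v) + 1 ∧ x = if (s + 1) % 2 = 0 then v else f' v) := by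
    intro x
    constructor
    · rintro ⟨v, ⟨hvU, hk⟩, hx⟩
      by_cases hvP : v ∈ P
      · simp only [hg, if_pos hvP, (hPmem v).1 hvP] at hk hx
        exact Or.inr ⟨v, hvP, hk, hx⟩
      · simp only [hg, if_neg hvP] at hk hx
        have hs : lb v ≤ s := by
          have := h.le v
          rw [hPmem] at hvP
          omega
        exact Or.inl ⟨v, hall v, hs, fun h2 => hvU ((hUmem v).2 ⟨hs, h2⟩), hk, hx⟩
    · rintro (⟨v, h0, hs, hv, hk, hx⟩ | ⟨v, hvP, hk, hx⟩)
      · have hvP : v ∉ P := by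
          rw [hPmem]
          omega
        refine ⟨v, ⟨fun h2 => hv ((hUmem v).1 h2).2, ?_⟩, ?_⟩
        · simpa only [hg, if_neg hvP] using hk
        · simpa only [hg, if_neg hvP] using hx
      · have hs := (hPmem v).1 hvP
        refine ⟨v, ⟨fun h2 => ?_, ?_⟩, ?_⟩
        · have := ((hUmem v).1 h2).1
          omega
        · simpa only [hg, if_pos hvP, hs] using hk
        · simpa only [hg, if_pos hvP, hs] using hx
  refine ⟨hseg.isZeroForcingSet fun x hx => (hS x).2 fun h' => hx ((hNS x).2 h'), ?_⟩
  have hcard := hseg.card_le (S := S) (r := s) (w := w)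
    (fun x hx h' => (hS x).1 hx ((hNS x).1 h')) hpos h.le (fun v hv => ((hUmem v).1 hv).1)
    (fun t => X (b t)) (fun t => hw _) (fun v hv => ((hUmem v).1 hv).2) ?_
  · refine hcard.trans ?_
    rw [mul_comm]
    exact Nat.mul_le_mul_left _ (le_zeroForcingNumber lb h.fort)
  -- An old neighbour `u` of `v` occurs no later than the bag `b (lb v - 1)`, and shares with `v` a
  -- bag after it; so `u` lies in that bag as well.
  · intro u hu v hv huv hlt
    have hvs := h.le v
    have hu1 := hpos u
    obtain ⟨i, hi, hui⟩ := (hcut (lb v - 1) u (by omega) (by omega)).1 (by omega)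
    obtain ⟨i', hui', hvi'⟩ := hX.edge_mem u v huv
    refine hX.interval u i _ i' hi ?_ hui hui'
    by_contra hcon
    have := (hcut (lb v - 1) v (by omega) (by omega)).2 ⟨i', by omega, hvi'⟩
    omega

end Progress

end Combinatorics

end ZeroForcing

/-! ### A program logic with running times -/

namespace RAM

/-- The program `p`, started in `s`, halts after some number `t` of steps in a state `s'` with
`Q t s'`. -/
def Does (p : Program) (s : State) (Q : ℕ → State → Prop) : Prop :=
  ∃ t s', Run p s t s' ∧ Q t s'

theorem Does.mono {p : Program} {s : State} {Q Q' : ℕ → State → Prop} (h : Does p s Q)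
    (hQ : ∀ t s', Q t s' → Q' t s') : Does p s Q' :=
  let ⟨t, s', hr, hq⟩ := h
  ⟨t, s', hr, hQ t s' hq⟩

section Instructions

variable {s : State} {Q : ℕ → State → Prop}

theorem does_skip : Does .skip s Q ↔ Q 1 s := by
  constructor
  · rintro ⟨t, s', h, hq⟩
    cases h
    exact hq
  · exact fun h => ⟨_, _, .skip s, h⟩

theorem does_const {x c : ℕ} : Does (.const x c) s Q ↔ Q 1 (s.setReg x c) := by
  constructor
  · rintro ⟨t, s', h, hq⟩
    cases h
    exact hq
  · exact fun h => ⟨_, _, .const x c s, h⟩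

theorem does_copy {x y : ℕ} : Does (.copy x y) s Q ↔ Q 1 (s.setReg x (s.reg y)) := by
  constructor
  · rintro ⟨t, s', h, hq⟩
    cases h
    exact hq
  · exact fun h => ⟨_, _, .copy x y s, h⟩

theorem does_inc {x : ℕ} : Does (.inc x) s Q ↔ Q 1 (s.setReg x (s.reg x + 1)) := by
  constructor
  · rintro ⟨t, s', h, hq⟩
    cases h
    exact hq
  · exact fun h => ⟨_, _, .inc x s, h⟩

theorem does_dec {x : ℕ} : Does (.dec x) s Q ↔ Q 1 (s.setReg x (s.reg x - 1)) := by
  constructor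
  · rintro ⟨t, s', h, hq⟩
    cases h
    exact hq
  · exact fun h => ⟨_, _, .dec x s, h⟩

theorem does_load {x a i : ℕ} :
    Does (.load x a i) s Q ↔ Q 1 (s.setReg x (s.arr a (s.reg i))) := by
  constructor
  · rintro ⟨t, s', h, hq⟩
    cases h
    exact hq
  · exact fun h => ⟨_, _, .load x a i s, h⟩

theorem does_store {x a i : ℕ} :
    Does (.store a i x) s Q ↔ Q 1 (s.setArr a (s.reg i) (s.reg x)) := by
  constructor
  · rintro ⟨t, s', h, hq⟩
    cases h
    exact hq
  · exact fun h => ⟨_, _, .store a i x s, h⟩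

theorem does_seq {p q : Program} :
    Does (.seq p q) s Q ↔ Does p s fun t s' => Does q s' fun t' s'' => Q (t + t') s'' := by
  constructor
  · rintro ⟨t, s', h, hq⟩
    cases h with
    | seq h1 h2 => exact ⟨_, _, h1, _, _, h2, hq⟩
  · rintro ⟨t, s', h, t', s'', h', hq⟩
    exact ⟨_, _, .seq h h', hq⟩

theorem does_ite {b : Cond} {p q : Program} :
    Does (.ite b p q) s Q ↔ (b.Holds s → Does p s fun t => Q (t + 1)) ∧
      (¬ b.Holds s → Does q s fun t => Q (t + 1)) := by
  constructor
  · rintro ⟨t, s', h, hq⟩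
    cases h with
    | ite_true hb h => exact ⟨fun _ => ⟨_, _, h, hq⟩, fun hb' => absurd hb hb'⟩
    | ite_false hb h => exact ⟨fun hb' => absurd hb' hb, fun _ => ⟨_, _, h, hq⟩⟩
  · rintro ⟨h1, h2⟩
    by_cases hb : b.Holds s
    · obtain ⟨t, s', h, hq⟩ := h1 hb
      exact ⟨_, _, .ite_true hb h, hq⟩
    · obtain ⟨t, s', h, hq⟩ := h2 hb
      exact ⟨_, _, .ite_false hb h, hq⟩

@[simp] theorem holds_lt {x y : ℕ} : (Cond.lt x y).Holds s ↔ s.reg x < s.reg y := Iff.rfl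

@[simp] theorem holds_eq {x y : ℕ} : (Cond.eq x y).Holds s ↔ s.reg x = s.reg y := Iff.rfl

/-- The loop rule: `I m s` says that the invariant holds with a budget of `m` further steps. -/
theorem does_loop {b : Cond} {p : Program} {I : ℕ → State → Prop} {m : ℕ} (h0 : I m s)
    (hstep : ∀ m s, I m s → b.Holds s → Does p s fun t s' => ∃ m', I m' s' ∧ t + 1 + m' ≤ m)
    (hexit : ∀ m' s' t, I m' s' → ¬ b.Holds s' → t + m' ≤ m + 1 → Q t s') :
    Does (.loop b p) s Q := by
  induction m using Nat.strong_induction_on generalizing s Q with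
  | _ m ih =>
    by_cases hb : b.Holds s
    -- The test alone costs a step, so the budget strictly decreases and also proves termination.
    · obtain ⟨t, s', hr, m', hI, hm⟩ := hstep m s h0 hb
      obtain ⟨t', s'', hr', hq⟩ := ih m' (by omega) hI
        (Q := fun t' s'' => Q (t + t' + 1) s'')
        fun m'' s'' t'' hI'' hb'' hle => hexit m'' s'' _ hI'' hb'' (by omega)
      exact ⟨_, _, .loop_true hb hr hr', hq⟩
    · exact ⟨1, s, .loop_false hb, hexit m s 1 h0 hb (by omega)⟩

end Instructions

section States

variable {s s' : State}

@[simp] theorem reg_setReg (s : State) (x v y : ℕ) :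
    (s.setReg x v).reg y = if y = x then v else s.reg y := by
  simp [State.setReg, Function.update_apply]

@[simp] theorem arr_setReg (s : State) (x v : ℕ) : (s.setReg x v).arr = s.arr := rfl

@[simp] theorem reg_setArr (s : State) (a i v : ℕ) : (s.setArr a i v).reg = s.reg := rfl

@[simp] theorem arr_setArr_self (s : State) (a i v : ℕ) :
    (s.setArr a i v).arr a = Function.update (s.arr a) i v := by
  simp [State.setArr]

@[simp] theorem arr_setArr_of_ne (s : State) {a b : ℕ} (i v : ℕ) (h : b ≠ a) :
    (s.setArr a i v).arr b = s.arr b := by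
  simp [State.setArr, h]

@[simp] theorem setReg_setReg (s : State) (x v w : ℕ) :
    (s.setReg x v).setReg x w = s.setReg x w := by
  simp [State.setReg]

/-- The registers below `r` and the arrays below `a` agree. -/
structure Frame (r a : ℕ) (s s' : State) : Prop where
  reg : ∀ x < r, s'.reg x = s.reg x
  arr : ∀ b < a, s'.arr b = s.arr b

theorem Frame.refl (r a : ℕ) (s : State) : Frame r a s s := ⟨fun _ _ => rfl, fun _ _ => rfl⟩

theorem Frame.trans {r a : ℕ} {s s' s'' : State} (h : Frame r a s s') (h' : Frame r a s' s'') :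
    Frame r a s s'' :=
  ⟨fun x hx => (h'.reg x hx).trans (h.reg x hx), fun b hb => (h'.arr b hb).trans (h.arr b hb)⟩

theorem Frame.mono {r a r' a' : ℕ} (h : Frame r a s s') (hr : r' ≤ r) (ha : a' ≤ a) :
    Frame r' a' s s' :=
  ⟨fun x hx => h.reg x (hx.trans_le hr), fun b hb => h.arr b (hb.trans_le ha)⟩

@[simp] theorem frame_setReg {r a x v : ℕ} (hx : r ≤ x) :
    Frame r a s (s'.setReg x v) ↔ Frame r a s s' := by
  have hne : ∀ y, y < r → y ≠ x := by omega
  constructor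
  · rintro ⟨h1, h2⟩
    exact ⟨fun y hy => by simpa [hne y hy] using h1 y hy, h2⟩
  · rintro ⟨h1, h2⟩
    exact ⟨fun y hy => by simpa [hne y hy] using h1 y hy, h2⟩

@[simp] theorem frame_setArr {r a b i v : ℕ} (hb : a ≤ b) :
    Frame r a s (s'.setArr b i v) ↔ Frame r a s s' := by
  have hne : ∀ y, y < a → y ≠ b := by omega
  constructor
  · rintro ⟨h1, h2⟩
    exact ⟨h1, fun y hy => by simpa [hne y hy] using h2 y hy⟩
  · rintro ⟨h1, h2⟩
    exact ⟨h1, fun y hy => by simpa [hne y hy] using h2 y hy⟩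

end States

/-- Run `body` with register `i` equal to `0, …, n - 1`, where `n` is in register `hi`. -/
def forRange (i hi : ℕ) (body : Program) : Program :=
  .seq (.const i 0) (.loop (.lt i hi) (.seq body (.inc i)))

/-- The 2 per round pays for the test and the increment, the final 2 for the initialisation and the
failing test. -/
theorem does_forRange {n i hi : ℕ} {body : Program} {s : State} {Q : ℕ → State → Prop}
    (I : ℕ → State → Prop) (c : Fin n → ℕ) (hhi : s.reg hi = n) (hne : hi ≠ i)
    (h0 : I 0 (s.setReg i 0))
    (hstep : ∀ (v : Fin n) s', I v s' → s'.reg i = v → s'.reg hi = n →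
      Does body s' fun t s'' => t ≤ c v ∧ s''.reg i = v ∧ s''.reg hi = n ∧
        I (v + 1) (s''.setReg i (v + 1)))
    (hexit : ∀ t s', I n s' → t ≤ ∑ v, (c v + 2) + 2 → Q t s') :
    Does (forRange i hi body) s Q := by
  set d : ℕ → ℕ := fun j => if h : j < n then c ⟨j, h⟩ + 2 else 0 with hd
  have hsum : ∑ v, (c v + 2) = ∑ j ∈ Finset.Ico 0 n, d j := by
    rw [Nat.Ico_zero_eq_range, ← Fin.sum_univ_eq_sum_range]
    simp [hd]
  rw [forRange, does_seq, does_const]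
  refine does_loop (I := fun m s => ∃ v ≤ n, m = ∑ j ∈ Finset.Ico v n, d j ∧ I v s ∧
    s.reg i = v ∧ s.reg hi = n) (m := ∑ j ∈ Finset.Ico 0 n, d j)
    ⟨0, Nat.zero_le _, rfl, h0, by simp, by simp [hne, hhi]⟩ ?_ ?_
  · rintro m s' ⟨v, hv, rfl, hI, hi1, hi2⟩ hb
    rw [holds_lt, hi1, hi2] at hb
    rw [does_seq]
    refine (hstep ⟨v, hb⟩ s' hI hi1 hi2).mono ?_
    rintro t s'' ⟨ht, h1, h2, h3⟩
    rw [does_inc]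
    refine ⟨_, ⟨v + 1, hb, rfl, ?_, ?_, ?_⟩, ?_⟩
    · rw [h1]
      exact h3
    · simp [h1]
    · simp [hne, h2]
    · rw [Finset.sum_eq_sum_Ico_succ_bot hb]
      simp only [hd, dif_pos hb]
      omega
  · rintro m s' t ⟨v, hv, rfl, hI, hi1, hi2⟩ hb hle
    rw [holds_lt, hi1, hi2] at hb
    obtain rfl : v = n := by omega
    refine hexit _ s' hI ?_
    rw [hsum]
    omega

/-- The arrays `off` and `ent` hold the offsets and the entries of a family of lists. -/
def Stored {n r : ℕ} (off ent : ℕ → ℕ) (L : Fin r → List (Fin n)) : Prop :=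
  ∀ v : Fin r, off (v + 1) = off v + (L v).length ∧
    ∀ i (h : i < (L v).length), ent (off v + i) = ((L v)[i] : Fin n)

/-- The coercion here acts on the whole list; this is the form in which it occurs in `entries` and
`Outputs`. -/
theorem map_coe_eq {n : ℕ} (l : List (Fin n)) :
    ((l : List ℕ).map fun v => v) = l.map Fin.val := by
  induction l with
  | nil => rfl
  | cons a l ih => simpa using ih

theorem entries_eq {n r : ℕ} (L : Fin r → List (Fin n)) (j : ℕ) :
    entries L j = ((List.ofFn L).flatten.map Fin.val).getD j 0 := by
  rw [entries, map_coe_eq]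

theorem stored_offsets_entries {n r : ℕ} (L : Fin r → List (Fin n)) :
    Stored (offsets L) (entries L) L := by
  intro v
  have hlen : (List.ofFn L).length = r := List.length_ofFn
  have hv : (v : ℕ) < (List.ofFn L).length := by simp
  have htake : (List.ofFn L).take (v + 1) = (List.ofFn L).take v ++ [L v] := by
    rw [List.take_succ_eq_append_getElem hv]
    simp
  have hdrop : (List.ofFn L) = (List.ofFn L).take v ++ L v :: (List.ofFn L).drop (v + 1) := by
    conv_lhs => rw [← List.take_append_drop (v + 1) (List.ofFn L), htake]
    simp
  have h1 : offsets L v = ((List.ofFn L).take v).flatten.length := by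
    rw [offsets, if_pos v.2.le, List.length_flatten]
  constructor
  · rw [h1, offsets, if_pos (show (v : ℕ) + 1 ≤ r from v.2), htake, List.length_flatten]
    simp
  · intro i hi
    have hflat : (List.ofFn L).flatten = ((List.ofFn L).take v).flatten ++
        (L v ++ ((List.ofFn L).drop (v + 1)).flatten) := by
      conv_lhs => rw [hdrop]
      simp
    rw [h1, entries_eq, hflat, List.map_append, List.map_append, List.getD_eq_getElem?_getD,
      List.getElem?_append_right (by rw [List.length_map]; omega), List.length_map,
      Nat.add_sub_cancel_left, List.getElem?_append_left (by rwa [List.length_map])]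
    simp [hi]

/-- Run `body` with register `x` equal to the elements of the list whose number is in register `i`,
in a family of lists with offsets in array `off` and entries in array `ent`. -/
def forList (off ent i lo hi x : ℕ) (body : Program) : Program :=
  .seq (.load lo off i) <| .seq (.copy hi i) <| .seq (.inc hi) <| .seq (.load hi off hi) <|
    .loop (.lt lo hi) (.seq (.load x ent lo) (.seq (.inc lo) body))

/-- The invariant is indexed by the prefix already read. Each element costs 3 steps besides the
body: load, increment and test. -/
theorem does_forList {n r off ent i lo hi x : ℕ} {body : Program} {s : State}
    {Q : ℕ → State → Prop} {L : Fin r → List (Fin n)} {v : Fin r}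
    (I : List (Fin n) → State → Prop) (c : ℕ)
    (hL : Stored (s.arr off) (s.arr ent) L) (hv : s.reg i = v) (hilo : i ≠ lo) (hlo : lo ≠ hi)
    (hxlo : x ≠ lo) (h0 : ∀ a b, I [] ((s.setReg lo a).setReg hi b))
    (hstep : ∀ (pre : List (Fin n)) (y : Fin n) (post : List (Fin n)) s' a, L v = pre ++ y :: post → I pre s' → s'.arr ent = s.arr ent →
      Does body ((s'.setReg x (y : ℕ)).setReg lo a) fun t s'' => t ≤ c ∧ s''.reg lo = a ∧
        s''.reg hi = s'.reg hi ∧ s''.arr ent = s.arr ent ∧ I (pre ++ [y]) s'')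
    (hexit : ∀ t s', I (L v) s' → t ≤ (L v).length * (c + 3) + 5 → Q t s') :
    Does (forList off ent i lo hi x body) s Q := by
  obtain ⟨hoff, hent⟩ := hL v
  have hlo' : hi ≠ lo := hlo.symm
  simp only [forList, does_seq, does_load, does_copy, does_inc, arr_setReg, reg_setReg,
    setReg_setReg, if_true, if_neg hilo, hv, hoff]
  refine does_loop (I := fun m s' => ∃ pre post, L v = pre ++ post ∧ m = post.length * (c + 3) ∧
    I pre s' ∧ s'.reg lo = s.arr off v + pre.length ∧
    s'.reg hi = s.arr off v + (L v).length ∧ s'.arr ent = s.arr ent)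
    (m := (L v).length * (c + 3)) ?_ ?_ ?_
  · refine ⟨[], L v, rfl, rfl, h0 _ _, ?_, ?_, rfl⟩
    · simp [hlo]
    · simp
  · rintro m s' ⟨pre, post, hpp, rfl, hI, h1, h2, h3⟩ hb
    rw [holds_lt, h1, h2, hpp] at hb
    obtain _ | ⟨y, post⟩ := post
    · simp at hb
    have hy : s'.arr ent (s'.reg lo) = (y : ℕ) := by
      rw [h3, h1, hent _ (by simp [hpp])]
      simp [hpp]
    simp only [does_seq, does_load, does_inc, reg_setReg, hy, if_neg hxlo.symm]
    refine (hstep pre y post s' (s'.reg lo + 1) hpp hI h3).mono ?_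
    rintro t s'' ⟨ht, e1, e2, e3, e4⟩
    refine ⟨_, ⟨pre ++ [y], post, by simp [hpp], rfl, e4, ?_, ?_, e3⟩, ?_⟩
    · simp [e1, h1, add_assoc]
    · rw [e2, h2]
    · simp only [List.length_cons, add_mul]
      omega
  · rintro m s' t ⟨pre, post, hpp, rfl, hI, h1, h2, h3⟩ hb hle
    rw [holds_lt, h1, h2, hpp] at hb
    obtain rfl : post = [] := by
      cases post with
      | nil => rfl
      | cons y post => simp at hb
    rw [List.append_nil] at hpp
    exact hexit _ s' (hpp ▸ hI) (by omega)

end RAM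

/-! ### The forcing process in linear time -/

namespace RAM

variable {n : ℕ} {N : Fin n → List (Fin n)} {G : SimpleGraph (Fin n)}

/-- The part of the memory on which all subroutines rely: register 0 holds `n`, registers 3 and 4
hold the constants 0 and 1, and arrays 0 and 1 hold the graph. -/
structure Base (N : Fin n → List (Fin n)) (s : State) : Prop where
  size : s.reg 0 = n
  zero : s.reg 3 = 0
  one : s.reg 4 = 1
  graph : Stored (s.arr 0) (s.arr 1) N

theorem Base.of_frame {s s' : State} {r a : ℕ} (h : Base N s) (hf : Frame r a s s')
    (hr : 5 ≤ r) (ha : 2 ≤ a) : Base N s' where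
  size := by rw [hf.reg 0 (by omega), h.size]
  zero := by rw [hf.reg 3 (by omega), h.zero]
  one := by rw [hf.reg 4 (by omega), h.one]
  graph := by
    rw [hf.arr 0 (by omega), hf.arr 1 (by omega)]
    exact h.graph

/-- The array `g` holds the characteristic function of `W`. -/
def Marks (g : ℕ → ℕ) (W : Finset (Fin n)) : Prop :=
  ∀ v : Fin n, g v = if v ∈ W then 1 else 0

theorem Marks.erase {g : ℕ → ℕ} {W : Finset (Fin n)} (h : Marks g W) (v : Fin n) :
    Marks (Function.update g v 0) (W.erase v) := by
  intro w
  by_cases hw : w = v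
  · simp [hw]
  · rw [Function.update_of_ne (by simpa [Fin.ext_iff] using hw), h w]
    simp [hw]

/-- The number of neighbours of `v` in `W`. -/
def whiteCount (N : Fin n → List (Fin n)) (W : Finset (Fin n)) (v : Fin n) : ℕ :=
  ((N v).filter (· ∈ W)).length

theorem whiteCount_erase {W : Finset (Fin n)} {v : Fin n} (hv : v ∈ W) {x : Fin n}
    (hnd : (N x).Nodup) : whiteCount N (W.erase v) x =
      if v ∈ N x then whiteCount N W x - 1 else whiteCount N W x := by
  have h : (N x).filter (· ∈ W.erase v) = ((N x).filter (· ∈ W)).erase v := by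
    rw [(hnd.filter _).erase_eq_filter, List.filter_filter]
    congr 1
    funext y
    by_cases hy : y = v <;> simp [hy]
  rw [whiteCount, h, List.length_erase]
  simp [hv, whiteCount]

/-- Copy the white set from array 6 to array 8. -/
def initColours : Program :=
  forRange 21 0 (.seq (.load 25 6 21) (.store 8 21 25))

theorem does_initColours {s : State} {Q : ℕ → State → Prop} {W : Finset (Fin n)} (hb : Base N s)
    (hW : Marks (s.arr 6) W)
    (hexit : ∀ t s', Frame 20 8 s s' → Marks (s'.arr 8) W → t ≤ 4 * n + 2 → Q t s') :
    Does initColours s Q := by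
  refine does_forRange (n := n) (fun v s' => Frame 20 8 s s' ∧
    ∀ w : Fin n, (w : ℕ) < v → s'.arr 8 w = if w ∈ W then 1 else 0) (fun _ => 2) hb.size
    (by norm_num) ⟨by simp [Frame.refl], by simp⟩ ?_ ?_
  · rintro v s' ⟨hF, hI⟩ h1 h2
    have h6 : s'.arr 6 v = if v ∈ W then 1 else 0 := by
      rw [hF.arr 6 (by norm_num), hW v]
    simp only [does_seq, does_load, does_store]
    refine ⟨by norm_num, by simp [h1], by simp [h2], by simpa using hF, fun w hw => ?_⟩
    by_cases hwv : w = v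
    · subst hwv
      simp [h1, h6]
    · have hne : (w : ℕ) ≠ v := by simpa [Fin.ext_iff] using hwv
      simpa [h1, hne] using hI w (by omega)
  · rintro t s' ⟨hF, hI⟩ ht
    refine hexit t s' hF (fun v => hI v v.2) ?_
    simp at ht
    omega

/-- Count the white neighbours of all vertices in array 10, and put all vertices on the stack. -/
def initCounts : Program :=
  forRange 21 0 <| .seq (.const 26 0) <|
    .seq (forList 0 1 21 22 23 24 (.seq (.load 25 8 24) (.ite (.eq 25 4) (.inc 26) .skip))) <|
    .seq (.store 10 21 26) (.store 11 21 21)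

theorem does_initCounts {s : State} {Q : ℕ → State → Prop} {W : Finset (Fin n)} (hb : Base N s)
    (hW : Marks (s.arr 8) W)
    (hexit : ∀ t s', Frame 20 10 s s' → (∀ v : Fin n, s'.arr 10 v = whiteCount N W v) →
      (∀ v : Fin n, s'.arr 11 v = v) → t ≤ 6 * ∑ v, (N v).length + 10 * n + 2 → Q t s') :
    Does initCounts s Q := by
  refine does_forRange (n := n) (fun v s' => Frame 20 10 s s' ∧
    ∀ w : Fin n, (w : ℕ) < v → s'.arr 10 w = whiteCount N W w ∧ s'.arr 11 w = w)
    (fun v => (N v).length * 6 + 8) hb.size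
    (by norm_num) ⟨by simp [Frame.refl], by simp⟩ ?_ ?_
  · rintro v s' ⟨hF, hI⟩ h1 h2
    have hb' := hb.of_frame hF (by norm_num) (by norm_num)
    simp only [does_seq, does_const, does_store]
    refine does_forList (v := v) (fun pre s'' => Frame 22 12 s' s'' ∧
      s''.reg 26 = (pre.filter (· ∈ W)).length) 3 (by simpa using hb'.graph) (by simp [h1])
      (by norm_num) (by norm_num) (by norm_num) ?_ ?_ ?_
    · intro a b
      simp [Frame.refl]
    · rintro pre y post s'' a hpp ⟨hF', hc⟩ -
      have h8 : s''.arr 8 y = if y ∈ W then 1 else 0 := by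
        rw [hF'.arr 8 (by norm_num), hF.arr 8 (by norm_num), hW y]
      have h4 : s''.reg 4 = 1 := by rw [hF'.reg 4 (by norm_num), hb'.one]
      simp only [does_seq, does_load, does_ite, does_inc, does_skip]
      by_cases hy : y ∈ W <;>
        simp [h8, hy, h4, hF', hc, hF'.arr 1, List.filter_append]
    · rintro t s'' ⟨hF', hc⟩ ht
      have e1 : s''.reg 21 = v := by rw [hF'.reg 21 (by norm_num), h1]
      refine ⟨by omega, by simp [e1], ?_, ?_, fun w hw => ?_⟩
      · simp [hF'.reg 0, h2]
      · simpa using hF.trans (hF'.mono (by norm_num) (by norm_num))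
      · by_cases hwv : w = v
        · subst hwv
          simp [e1, hc, whiteCount]
        · have hne : (w : ℕ) ≠ v := by simpa [Fin.ext_iff] using hwv
          simpa [e1, hne, hF'.arr 10, hF'.arr 11] using hI w (by omega)
  · rintro t s' ⟨hF, hI⟩ ht
    refine hexit t s' hF (fun v => (hI v v.2).1) (fun v => (hI v v.2).2) ?_
    simp only [Finset.sum_add_distrib, ← Finset.sum_mul, Finset.sum_const, Finset.card_univ,
      Fintype.card_fin, smul_eq_mul] at ht
    omega

/-- Find the white neighbour of the vertex in register 21. -/
def findWhite : Program :=
  forList 0 1 21 22 23 24 (.seq (.load 25 8 24) (.ite (.eq 25 4) (.copy 28 24) .skip))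

theorem does_findWhite {s : State} {Q : ℕ → State → Prop} {W : Finset (Fin n)} (hb : Base N s)
    (hW : Marks (s.arr 8) W) {u v : Fin n} (hu : s.reg 21 = u) (hvu : v ∈ N u) (hvW : v ∈ W)
    (huniq : ∀ x ∈ N u, x ∈ W → x = v)
    (hexit : ∀ t s', Frame 22 12 s s' → s'.reg 27 = s.reg 27 → s'.reg 28 = v →
      t ≤ 6 * (N u).length + 5 → Q t s') :
    Does findWhite s Q := by
  refine does_forList (v := u) (fun pre s' => Frame 22 12 s s' ∧ s'.reg 27 = s.reg 27 ∧
    (v ∈ pre → s'.reg 28 = v)) 3 hb.graph hu (by norm_num) (by norm_num) (by norm_num) ?_ ?_ ?_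
  · intro a b
    simp [Frame.refl]
  · rintro pre y post s' a hpp ⟨hF, h27, h28⟩ -
    have hyu : y ∈ N u := by simp [hpp]
    have h8 : s'.arr 8 y = if y ∈ W then 1 else 0 := by rw [hF.arr 8 (by norm_num), hW y]
    have h4 : s'.reg 4 = 1 := by rw [hF.reg 4 (by norm_num), hb.one]
    simp only [does_seq, does_load, does_ite, does_copy, does_skip]
    by_cases hy : y ∈ W
    · obtain rfl := huniq y hyu hy
      simp [h8, hy, h4, hF, h27, hF.arr 1]
    · have hne : v ≠ y := fun e => hy (e ▸ hvW)
      simpa [h8, hy, h4, hF, h27, hF.arr 1, hne] using h28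
  · rintro t s' ⟨hF, h27, h28⟩ ht
    exact hexit t s' hF h27 (h28 hvu) (by omega)

/-- Adjust the counts of the neighbours of the vertex in register 28 and put them on the stack. -/
def pushNeighbours : Program :=
  forList 0 1 28 22 23 24 <| .seq (.load 25 10 24) <| .seq (.dec 25) <| .seq (.store 10 24 25) <|
    .seq (.store 11 27 24) (.inc 27)

theorem does_pushNeighbours {s : State} {Q : ℕ → State → Prop} (hb : Base N s) {v : Fin n}
    (hv : s.reg 28 = v) (hnd : (N v).Nodup)
    (hexit : ∀ t s', Frame 22 10 s s' →
      (∀ x : Fin n, s'.arr 10 x = if x ∈ N v then s.arr 10 x - 1 else s.arr 10 x) →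
      s'.reg 27 = s.reg 27 + (N v).length → (∀ i < s.reg 27, s'.arr 11 i = s.arr 11 i) →
      (∀ i, s.reg 27 ≤ i → i < s'.reg 27 → ∃ x : Fin n, s'.arr 11 i = x) →
      (∀ x ∈ N v, ∃ i < s'.reg 27, s'.arr 11 i = x) → t ≤ 8 * (N v).length + 5 → Q t s') :
    Does pushNeighbours s Q := by
  refine does_forList (v := v) (fun pre s' => Frame 22 10 s s' ∧
    (∀ x : Fin n, s'.arr 10 x = if x ∈ pre then s.arr 10 x - 1 else s.arr 10 x) ∧
    s'.reg 27 = s.reg 27 + pre.length ∧ (∀ i < s.reg 27, s'.arr 11 i = s.arr 11 i) ∧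
    (∀ i, s.reg 27 ≤ i → i < s'.reg 27 → ∃ x : Fin n, s'.arr 11 i = x) ∧
    (∀ x ∈ pre, ∃ i < s'.reg 27, s'.arr 11 i = x)) 5 hb.graph hv (by norm_num) (by norm_num)
    (by norm_num) ?_ ?_ ?_
  · intro a b
    simp only [arr_setReg, reg_setReg]
    refine ⟨by simp [Frame.refl], by simp, by simp, by simp, ?_, by simp⟩
    intro i h1 h2
    simp at h2
    omega
  · rintro pre y post s' a hpp ⟨hF, h10, h27, hold, hnew, hpre⟩ -
    have hy : y ∉ pre := by
      rw [hpp, List.nodup_append] at hnd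
      intro h
      exact hnd.2.2 y h y (by simp) rfl
    simp only [does_seq, does_load, does_dec, does_store, does_inc]
    refine ⟨by norm_num, by simp, by simp, by simp [hF.arr 1], by simpa using hF, ?_, ?_, ?_, ?_, ?_⟩
    · intro x
      by_cases hx : x = y
      · subst hx
        simp [h10, hy]
      · have hne : (x : ℕ) ≠ y := by simpa [Fin.ext_iff] using hx
        simp [h10, hx, hne]
    · simp [h27, add_assoc]
    · intro i hi
      have hne : i ≠ s'.reg 27 := by omega
      simpa [hne] using hold i hi
    · intro i h1 h2
      by_cases hi : i = s'.reg 27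
      · exact ⟨y, by simp [hi]⟩
      · simp at h2
        simpa [hi] using hnew i h1 (by omega)
    · intro x hx
      rcases List.mem_append.1 hx with hx | hx
      · obtain ⟨i, hi, hxi⟩ := hpre x hx
        exact ⟨i, by simp; omega, by simpa [hi.ne] using hxi⟩
      · obtain rfl := List.mem_singleton.1 hx
        exact ⟨s'.reg 27, by simp, by simp⟩
  · rintro t s' ⟨hF, h10, h27, hold, hnew, hpre⟩ ht
    exact hexit t s' hF h10 h27 hold hnew hpre (by omega)

/-- The vertex in register 21 forces its unique white neighbour. -/
def force : Program :=
  .seq findWhite <| .seq (.store 8 28 3) <| .seq (.store 9 28 21) <| .seq (.store 11 27 28) <|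
    .seq (.inc 27) pushNeighbours

theorem does_force {s : State} {Q : ℕ → State → Prop} {W : Finset (Fin n)} (hb : Base N s)
    (hW : Marks (s.arr 8) W) {u v : Fin n} (hu : s.reg 21 = u) (hvu : v ∈ N u) (hvW : v ∈ W)
    (huniq : ∀ x ∈ N u, x ∈ W → x = v) (hnd : (N v).Nodup)
    (hexit : ∀ t s', Frame 20 8 s s' → Marks (s'.arr 8) (W.erase v) →
      s'.arr 9 = Function.update (s.arr 9) v u →
      (∀ x : Fin n, s'.arr 10 x = if x ∈ N v then s.arr 10 x - 1 else s.arr 10 x) →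
      s'.reg 27 = s.reg 27 + (N v).length + 1 → (∀ i < s.reg 27, s'.arr 11 i = s.arr 11 i) →
      (∀ i, s.reg 27 ≤ i → i < s'.reg 27 → ∃ x : Fin n, s'.arr 11 i = x) →
      (∀ x, x = v ∨ x ∈ N v → ∃ i < s'.reg 27, s'.arr 11 i = x) →
      t ≤ 6 * (N u).length + 8 * (N v).length + 14 → Q t s') :
    Does force s Q := by
  rw [force, does_seq]
  refine does_findWhite hb hW hu hvu hvW huniq ?_
  intro t₁ s₁ hF₁ h27 h28 ht₁
  simp only [does_seq, does_store, does_inc]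
  have hb₁ := hb.of_frame hF₁ (by norm_num) (by norm_num)
  have h21 : s₁.reg 21 = u := by rw [hF₁.reg 21 (by norm_num), hu]
  refine does_pushNeighbours (N := N) (v := v) ⟨?_, ?_, ?_, ?_⟩ ?_ hnd ?_
  · simpa using hb₁.size
  · simpa using hb₁.zero
  · simpa using hb₁.one
  · simpa using hb₁.graph
  · simpa using h28
  intro t₂ s₂ hF₂ h10 h27' hold hnew hpush ht₂
  have e8 : s₂.arr 8 = Function.update (s.arr 8) v 0 := by
    rw [hF₂.arr 8 (by norm_num)]
    simp [h28, hb₁.zero, hF₁.arr 8]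
  have e9 : s₂.arr 9 = Function.update (s.arr 9) v u := by
    rw [hF₂.arr 9 (by norm_num)]
    simp [h28, h21, hF₁.arr 9]
  simp only [reg_setReg, reg_setArr, arr_setReg, h27, h28, h21, if_true, ne_eq,
    not_false_eq_true, Nat.reduceEqDiff, arr_setArr_of_ne,
    arr_setArr_self, hF₁.arr 10 (by norm_num), hF₁.arr 11 (by norm_num)] at h10 h27' hold hnew
  refine hexit _ s₂ ?_ (e8 ▸ hW.erase v) e9 h10 (by omega) ?_ ?_ ?_ (by omega)
  · refine Frame.trans ?_ (hF₂.mono (by norm_num) (by norm_num))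
    simpa using hF₁.mono (by norm_num) (by norm_num)
  · intro i hi
    rw [hold i (by omega), Function.update_of_ne (by omega)]
  · intro i h1 h2
    by_cases hi : i = s.reg 27
    · refine ⟨v, ?_⟩
      rw [hold i (by omega), hi, Function.update_self]
    · exact hnew i (by omega) h2
  · rintro x (rfl | hx)
    · refine ⟨s.reg 27, by omega, ?_⟩
      rw [hold _ (by omega), Function.update_self]
    · exact hpush x hx

/-- The forcing process: every blue vertex with exactly one white neighbour is on the stack. -/
def propagate : Program :=
  .loop (.lt 3 27) <| .seq (.dec 27) <| .seq (.load 21 11 27) <| .seq (.load 25 8 21) <|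
    .seq (.load 26 10 21) <| .ite (.eq 25 3) (.ite (.eq 26 4) force .skip) .skip

/-- The part of the time bound for the forcing process that depends on the white set. -/
def potential (N : Fin n → List (Fin n)) (W : Finset (Fin n)) : ℕ :=
  ∑ v ∈ W, (17 * (N v).length + 30) + ∑ u with whiteCount N W u ≠ 0, 6 * (N u).length

/-- This pays for one force. Per neighbour of `v`, 8 steps adjust its count and 9 are reserved for
its new stack entry. The scan of `N u` is paid once, since `u` has no white neighbour left
afterwards. -/
theorem potential_erase {W : Finset (Fin n)} (hN : ∀ v, (N v).Nodup) {u v : Fin n} (hv : v ∈ W)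
    (hvu : v ∈ N u) (hu : whiteCount N W u = 1) :
    potential N (W.erase v) + (17 * (N v).length + 30) + 6 * (N u).length ≤ potential N W := by
  have h1 := Finset.add_sum_erase W (fun v => 17 * (N v).length + 30) hv
  have h2 : (Finset.univ.filter fun x => whiteCount N (W.erase v) x ≠ 0) ⊆
      (Finset.univ.filter fun x => whiteCount N W x ≠ 0).erase u := by
    intro x hx
    simp only [Finset.mem_filter, Finset.mem_univ, true_and, Finset.mem_erase] at hx ⊢
    rw [whiteCount_erase hv (hN x)] at hx
    refine ⟨?_, ?_⟩
    · rintro rfl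
      simp [hvu, hu] at hx
    · split_ifs at hx <;> omega
  have h3 := Finset.sum_le_sum_of_subset (f := fun u => 6 * (N u).length) h2
  have h4 := Finset.add_sum_erase (Finset.univ.filter fun x => whiteCount N W x ≠ 0)
    (fun u => 6 * (N u).length) (a := u) (by simp [hu])
  simp only [potential]
  omega

theorem potential_le (N : Fin n → List (Fin n)) (W : Finset (Fin n)) :
    potential N W ≤ 23 * ∑ v, (N v).length + 30 * n := by
  have h1 := Finset.sum_le_sum_of_subset (f := fun v => 17 * (N v).length + 30)
    (Finset.subset_univ W)
  have h2 := Finset.sum_le_sum_of_subset (f := fun u => 6 * (N u).length)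
    (Finset.subset_univ (Finset.univ.filter fun u => whiteCount N W u ≠ 0))
  simp only [Finset.sum_add_distrib, ← Finset.mul_sum, Finset.sum_const, Finset.card_univ,
    Fintype.card_fin, smul_eq_mul] at h1 h2
  simp only [potential, Finset.sum_add_distrib, ← Finset.mul_sum, Finset.sum_const, smul_eq_mul]
  omega

-- Forcing `v` changes only the colour of `v` and the counts of its neighbours, and all of these are
-- pushed. So every vertex able to force is on the stack, and an empty stack means that the process
-- is stuck. Outdated or repeated entries do no harm; each has 9 steps reserved for its removal.
open ZeroForcing in
theorem does_propagate {s : State} {Q : ℕ → State → Prop} {P : Finset (Fin n)} (hb : Base N s)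
    (hN : ∀ v, Lists (N v) (G.neighborSet v)) (hW : Marks (s.arr 8) P)
    (h10 : ∀ v : Fin n, s.arr 10 v = whiteCount N P v) (h11 : ∀ v : Fin n, s.arr 11 v = v)
    (h27 : s.reg 27 = n)
    (hexit : ∀ t s' W f τ, Frame 20 8 s s' → PartlyForces G P W f τ → Marks (s'.arr 8) W →
      (∀ v ∈ P \ W, s'.arr 9 v = f v) → (∀ u ∉ W, whiteCount N W u ≠ 1) →
      t ≤ 23 * ∑ v, (N v).length + 39 * n + 1 → Q t s') :
    Does propagate s Q := by
  refine does_loop (I := fun m s' => ∃ W f τ, Frame 20 8 s s' ∧ PartlyForces G P W f τ ∧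
    Marks (s'.arr 8) W ∧ (∀ v ∈ P \ W, s'.arr 9 v = f v) ∧
    (∀ v : Fin n, s'.arr 10 v = whiteCount N W v) ∧
    (∀ i < s'.reg 27, ∃ u : Fin n, s'.arr 11 i = u) ∧
    (∀ u ∉ W, whiteCount N W u = 1 → ∃ i < s'.reg 27, s'.arr 11 i = u) ∧
    m = 9 * s'.reg 27 + potential N W) (m := 9 * n + potential N P) ?_ ?_ ?_
  · refine ⟨P, id, fun _ => 0, Frame.refl _ _ _, partlyForces_self _ _ _, hW, by simp, h10, ?_, ?_,
      by rw [h27]⟩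
    · intro i hi
      exact ⟨⟨i, h27 ▸ hi⟩, h11 ⟨i, h27 ▸ hi⟩⟩
    · intro u _ _
      exact ⟨u, h27 ▸ u.2, h11 u⟩
  · rintro m s' ⟨W, f, τ, hF, hPF, h8, h9, h10, hst, hall, rfl⟩ hlt
    have hb' := hb.of_frame hF (by norm_num) (by norm_num)
    rw [holds_lt, hb'.zero] at hlt
    obtain ⟨u, hu⟩ := hst (s'.reg 27 - 1) (by omega)
    simp only [does_seq, does_dec, does_load, does_ite, holds_eq, does_skip, reg_setReg,
      arr_setReg, if_true, Nat.reduceEqDiff, if_false, hu, h8 u, h10 u,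
      hb'.zero, hb'.one]
    -- The case in which the popped vertex cannot force.
    have hpop : ∀ s'' t, Frame 20 12 s' s'' → s''.reg 27 = s'.reg 27 - 1 →
        (u ∉ W → whiteCount N W u ≠ 1) → t + 1 ≤ 9 → ∃ m', (∃ W f τ, Frame 20 8 s s'' ∧
          PartlyForces G P W f τ ∧ Marks (s''.arr 8) W ∧ (∀ v ∈ P \ W, s''.arr 9 v = f v) ∧
          (∀ v : Fin n, s''.arr 10 v = whiteCount N W v) ∧
          (∀ i < s''.reg 27, ∃ u : Fin n, s''.arr 11 i = u) ∧
          (∀ u ∉ W, whiteCount N W u = 1 → ∃ i < s''.reg 27, s''.arr 11 i = u) ∧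
          m' = 9 * s''.reg 27 + potential N W) ∧
          t + 1 + m' ≤ 9 * s'.reg 27 + potential N W := by
      intro s'' t hF' h27' hun ht
      refine ⟨_, ⟨W, f, τ, hF.trans (hF'.mono (by norm_num) (by norm_num)), hPF, ?_, ?_, ?_, ?_, ?_,
        rfl⟩, by rw [h27']; omega⟩
      · rwa [hF'.arr 8 (by norm_num)]
      · rwa [hF'.arr 9 (by norm_num)]
      · rwa [hF'.arr 10 (by norm_num)]
      · intro i hi
        rw [hF'.arr 11 (by norm_num)]
        exact hst i (by omega)
      · intro x hx hx1
        rw [hF'.arr 11 (by norm_num)]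
        obtain ⟨i, hi, hxi⟩ := hall x hx hx1
        refine ⟨i, ?_, hxi⟩
        by_contra hcon
        obtain rfl : i = s'.reg 27 - 1 := by omega
        obtain rfl : u = x := Fin.ext (hu.symm.trans hxi)
        exact hun hx hx1
    refine ⟨fun hblue => ⟨fun hone => ?_, fun hone => ?_⟩, fun hwhite => ?_⟩
    · have huW : u ∉ W := by
        intro h
        simp [h] at hblue
      obtain ⟨v, hv⟩ := List.length_eq_one_iff.1 hone
      have hmem : ∀ x, x ∈ N u ∧ x ∈ W ↔ x = v := by
        intro x
        have : x ∈ (N u).filter (· ∈ W) ↔ x ∈ [v] := by rw [hv]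
        simpa using this
      obtain ⟨hvu, hvW⟩ := (hmem v).2 rfl
      refine does_force (N := N) (W := W) (u := u) (v := v) ⟨?_, ?_, ?_, ?_⟩ ?_ ?_ hvu hvW
        (fun x hx hxW => (hmem x).1 ⟨hx, hxW⟩) (hN v).1 ?_
      · simpa using hb'.size
      · simpa using hb'.zero
      · simpa using hb'.one
      · simpa using hb'.graph
      · simpa using h8
      · simp
      intro t s'' hF' g8 g9 g10 g27 gold gnew gpush ht
      simp only [arr_setReg, reg_setReg, if_true, Nat.reduceEqDiff, if_false] at g9 g10 g27 gold gnew
      replace hF' := Frame.trans (s := s') (by simp [Frame.refl]) hF'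
      have hwc := fun x => whiteCount_erase (W := W) hvW (hN x).1
      have hsymm : ∀ x, x ∈ N v ↔ v ∈ N x := by
        intro x
        rw [(hN v).2, (hN x).2, SimpleGraph.mem_neighborSet, SimpleGraph.mem_neighborSet,
          SimpleGraph.adj_comm]
      have hpot := potential_erase (fun x => (hN x).1) hvW hvu hone
      refine ⟨_, ⟨W.erase v, _, _, hF.trans hF', hPF.step huW hvW ?_ ?_, g8, ?_, ?_, ?_, ?_, rfl⟩, ?_⟩
      · exact ((hN u).2 v).1 hvu
      · intro x hxW hux
        exact (hmem x).1 ⟨((hN u).2 x).2 hux, hxW⟩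
      · intro w hw
        rw [g9]
        by_cases hwv : w = v
        · subst hwv
          simp
        · rw [Function.update_of_ne (by simpa [Fin.ext_iff] using hwv),
            Function.update_of_ne hwv]
          refine h9 w ?_
          simp only [Finset.mem_sdiff, Finset.mem_erase] at hw ⊢
          exact ⟨hw.1, fun h => hw.2 ⟨hwv, h⟩⟩
      · intro x
        rw [g10, hwc, h10]
        simp only [hsymm]
      · intro i hi
        by_cases hi' : i < s'.reg 27 - 1
        · rw [gold i hi']
          exact hst i (by omega)
        · exact gnew i (by omega) hi
      · intro x hx hx1
        by_cases hxv : x = v ∨ x ∈ N v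
        · exact gpush x hxv
        · push Not at hxv
          -- The count of `x` is unchanged, so `x` was already on the stack; it is not the popped
          -- vertex `u`, which is a neighbour of `v`.
          rw [hwc, if_neg (fun h => hxv.2 ((hsymm x).2 h))] at hx1
          have hxW : x ∉ W := fun h => hx (Finset.mem_erase.2 ⟨hxv.1, h⟩)
          obtain ⟨i, hi, hxi⟩ := hall x hxW hx1
          by_cases hi' : i < s'.reg 27 - 1
          · exact ⟨i, by omega, by rw [gold i hi', hxi]⟩
          · obtain rfl : i = s'.reg 27 - 1 := by omega
            obtain rfl : u = x := Fin.ext (hu.symm.trans hxi)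
            exact absurd ((hsymm u).2 hvu) hxv.2
      · rw [g27]
        omega
    · refine hpop _ _ (by simp [Frame.refl]) (by simp) (fun _ => hone) (by norm_num)
    · refine hpop _ _ (by simp [Frame.refl]) (by simp) (fun h => ?_) (by norm_num)
      simp [h] at hwhite
  · rintro m s' t ⟨W, f, τ, hF, hPF, h8, h9, h10, hst, hall, rfl⟩ hlt ht
    have hb' := hb.of_frame hF (by norm_num) (by norm_num)
    rw [holds_lt, hb'.zero] at hlt
    have hpot := potential_le N P
    refine hexit t s' W f τ hF hPF h8 h9 (fun u hu hu1 => ?_) (by omega)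
    obtain ⟨i, hi, -⟩ := hall u hu hu1
    omega

/-- Set register 20 to 1 if a white vertex is left, and to 0 otherwise. -/
def checkWhite : Program :=
  .seq (.copy 20 3) <| forRange 21 0 (.seq (.load 25 8 21) (.ite (.eq 25 4) (.copy 20 4) .skip))

theorem does_checkWhite {s : State} {Q : ℕ → State → Prop} {W : Finset (Fin n)} (hb : Base N s)
    (hW : Marks (s.arr 8) W)
    (hexit : ∀ t s', Frame 20 12 s s' → (s'.reg 20 = if W = ∅ then 0 else 1) →
      t ≤ 5 * n + 3 → Q t s') :
    Does checkWhite s Q := by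
  classical
  rw [checkWhite, does_seq, does_copy]
  refine does_forRange (n := n) (fun v s' => Frame 20 12 s s' ∧
    s'.reg 20 = if ∃ w ∈ W, (w : ℕ) < v then 1 else 0) (fun _ => 3) (by simpa using hb.size)
    (by norm_num) ⟨by simp [Frame.refl], by simp [hb.zero]⟩ ?_ ?_
  · rintro v s' ⟨hF, h20⟩ h1 h2
    have h8 : s'.arr 8 v = if v ∈ W then 1 else 0 := by rw [hF.arr 8 (by norm_num), hW v]
    have h4 : s'.reg 4 = 1 := by rw [hF.reg 4 (by norm_num), hb.one]
    simp only [does_seq, does_load, does_ite, does_copy, does_skip]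
    by_cases hv : v ∈ W
    · simp only [reg_setReg, h1, h8, hv, h4, if_true]
      simpa [h2, h4, hF] using ⟨v, hv, le_rfl⟩
    · have : (∃ w ∈ W, (w : ℕ) < v + 1) ↔ ∃ w ∈ W, (w : ℕ) < v := by
        refine ⟨fun ⟨w, hw, hlt⟩ => ⟨w, hw, ?_⟩, fun ⟨w, hw, hlt⟩ => ⟨w, hw, by omega⟩⟩
        have : (w : ℕ) ≠ v := fun e => hv (Fin.ext e ▸ hw)
        omega
      simp only [this]
      simp [h1, h2, h8, hv, h4, hF, h20]
  · rintro t s' ⟨hF, h20⟩ ht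
    refine hexit _ s' hF ?_ ?_
    · rw [h20]
      by_cases hW0 : W = ∅
      · simp [hW0]
      · obtain ⟨w, hw⟩ := Finset.nonempty_iff_ne_empty.2 hW0
        rw [if_pos ⟨w, hw, w.2⟩, if_neg hW0]
    · simp at ht
      omega

/-- Run the forcing process for the white set in array 6.  Register 20 is 0 if no white vertex is
left, and then array 9 holds the forcers. -/
def closure : Program :=
  .seq initColours <| .seq initCounts <| .seq (.copy 27 0) <| .seq propagate checkWhite

-- When the process is stuck, no blue vertex has exactly one white neighbour, so a nonempty
-- remaining white set is a fort.
open ZeroForcing in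
theorem does_closure {s : State} {Q : ℕ → State → Prop} {P : Finset (Fin n)} (hb : Base N s)
    (hN : ∀ v, Lists (N v) (G.neighborSet v)) (hP : Marks (s.arr 6) P)
    (hexit : ∀ t s', Frame 20 8 s s' →
      ((s'.reg 20 = 0 ∧ ∃ f τ, Forces G P f τ ∧ ∀ v ∈ P, s'.arr 9 v = f v) ∨
        (s'.reg 20 = 1 ∧ ∃ F ⊆ P, IsFort G F)) →
      t ≤ 29 * ∑ v, (N v).length + 58 * n + 9 → Q t s') :
    Does closure s Q := by
  rw [closure, does_seq]
  refine does_initColours hb hP fun t₁ s₁ hF₁ h8₁ ht₁ => ?_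
  have hb₁ := hb.of_frame hF₁ (by norm_num) (by norm_num)
  rw [does_seq]
  refine does_initCounts hb₁ h8₁ fun t₂ s₂ hF₂ h10₂ h11₂ ht₂ => ?_
  have hb₂ := hb₁.of_frame hF₂ (by norm_num) (by norm_num)
  have hF₃ : Frame 20 8 s (s₂.setReg 27 (s₂.reg 0)) := by
    simpa using hF₁.trans (hF₂.mono (by norm_num) (by norm_num))
  have hb₃ := hb.of_frame hF₃ (by norm_num) (by norm_num)
  rw [does_seq, does_copy, does_seq]
  refine does_propagate (P := P) hb₃ hN ?_ h10₂ h11₂ (by simp [hb₂.size])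
    fun t₄ s₄ W f τ hF₄ hPF h8₄ h9₄ hstuck ht₄ => ?_
  · rw [arr_setReg, hF₂.arr 8 (by norm_num)]
    exact h8₁
  have hb₄ := hb₃.of_frame hF₄ (by norm_num) (by norm_num)
  refine does_checkWhite hb₄ h8₄ fun t₅ s₅ hF₅ h20 ht₅ => ?_
  refine hexit _ s₅ (hF₃.trans (hF₄.trans (hF₅.mono (by norm_num) (by norm_num)))) ?_ (by omega)
  by_cases hW : W = ∅
  · subst hW
    refine Or.inl ⟨by simpa using h20, f, τ, hPF.forces, fun v hv => ?_⟩
    rw [hF₅.arr 9 (by norm_num), h9₄ v (by simpa using hv)]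
  · refine Or.inr ⟨by simpa [hW] using h20, W, hPF.1, Finset.nonempty_iff_ne_empty.2 hW, ?_⟩
    rintro u hu ⟨v, hv, huv, huniq⟩
    refine hstuck u hu ?_
    have hperm : (N u).filter (· ∈ W) = (N u).filter (· = v) := by
      refine List.filter_congr fun x hx => ?_
      have hux := ((hN u).2 x).1 hx
      by_cases hxv : x = v
      · simp [hxv, hv]
      · have : x ∉ W := fun h => hxv (huniq x h hux)
        simp [hxv, this]
    rw [whiteCount, hperm, ← List.countP_eq_length_filter]
    exact List.count_eq_one_of_mem (hN u).1 (((hN u).2 v).2 huv)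

end RAM

/-! ### Reading bags, recording chains and the output -/

namespace RAM

open ZeroForcing

variable {n k : ℕ} {N : Fin n → List (Fin n)} {B : Fin k → List (Fin n)} {G : SimpleGraph (Fin n)}
  {X : ℕ → Finset (Fin n)}

/-- Read the bag whose number is in register 5: label its new vertices with the content of
register 6, mark them in array 6, and set register 9 to 1 if there are any. -/
def readBag : Program :=
  .seq (.const 9 0) <| forList 2 3 5 22 23 24 <| .seq (.load 25 5 24) <|
    .ite (.eq 25 3) (.seq (.store 5 24 6) (.seq (.store 6 24 4) (.copy 9 4))) .skip

theorem does_readBag {st : State} {Q : ℕ → State → Prop} {s : ℕ} {lb : Fin n → ℕ} {j : Fin k}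
    (hb : Base N st) (hB : Stored (st.arr 2) (st.arr 3) B) (hX : ∀ v, v ∈ B j ↔ v ∈ X j)
    (hj : st.reg 5 = j) (hs : st.reg 6 = s + 1) (hlb : ∀ v : Fin n, st.arr 5 v = lb v)
    (hW : Marks (st.arr 6) (Finset.univ.filter fun v => lb v = s + 1))
    (hexit : ∀ t st', Frame 9 5 st st' → st'.arr 7 = st.arr 7 →
      (∀ v : Fin n, st'.arr 5 v = relabel X j s lb v) →
      Marks (st'.arr 6) (Finset.univ.filter fun v => relabel X j s lb v = s + 1) →
      (st'.reg 9 = if ∃ v ∈ X j, lb v = 0 then 1 else 0) → t ≤ 8 * (B j).length + 6 → Q t st') :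
    Does readBag st Q := by
  classical
  rw [readBag, does_seq, does_const]
  refine does_forList (v := j) (fun pre st' => Frame 9 5 st st' ∧ st'.arr 7 = st.arr 7 ∧
    (∀ v : Fin n, st'.arr 5 v = if lb v = 0 ∧ v ∈ pre then s + 1 else lb v) ∧
    (∀ v : Fin n, st'.arr 6 v = if (lb v = 0 ∧ v ∈ pre) ∨ lb v = s + 1 then 1 else 0) ∧
    st'.reg 9 = if ∃ v ∈ pre, lb v = 0 then 1 else 0) 5 (by simpa using hB) (by simpa using hj)
    (by norm_num) (by norm_num) (by norm_num) ?_ ?_ ?_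
  · intro a b
    refine ⟨by simp [Frame.refl], by simp, by simpa using hlb, ?_, by simp⟩
    intro v
    simpa using hW v
  · rintro pre y post st' a hpp ⟨hF, h7, h5, h6, h9⟩ -
    have h3 : st'.reg 3 = 0 := by rw [hF.reg 3 (by norm_num), hb.zero]
    have h4 : st'.reg 4 = 1 := by rw [hF.reg 4 (by norm_num), hb.one]
    have hcur : st'.reg 6 = s + 1 := by rw [hF.reg 6 (by norm_num), hs]
    have hy5 := h5 y
    simp only [does_seq, does_load, does_ite, does_store, does_copy, does_skip, holds_eq]
    by_cases hnew : lb y = 0 ∧ y ∉ pre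
    · refine ⟨fun _ => ⟨by norm_num, by simp, by simp, by simp [hF.arr 3], by simpa using hF,
        by simp [h7], ?_, ?_, ?_⟩, fun hne => ?_⟩
      · intro v
        by_cases hv : v = y
        · subst hv
          simp [hcur, hnew.1]
        · have hne : (v : ℕ) ≠ y := by simpa [Fin.ext_iff] using hv
          simpa [hne, hv] using h5 v
      · intro v
        by_cases hv : v = y
        · subst hv
          simp [h4, hnew.1]
        · have hne : (v : ℕ) ≠ y := by simpa [Fin.ext_iff] using hv
          simpa [hne, hv] using h6 v
      · have : ∃ v ∈ pre ++ [y], lb v = 0 := ⟨y, by simp, hnew.1⟩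
        simp only [if_pos this]
        simp [h4]
      · simp [hy5, h3, hnew] at hne
    · have hne : st'.arr 5 y ≠ 0 := by
        rw [hy5]
        split_ifs <;> tauto
      have hcond : ∀ v, (lb v = 0 ∧ v ∈ pre ++ [y]) ↔ (lb v = 0 ∧ v ∈ pre) := by
        intro v
        simp only [List.mem_append, List.mem_singleton]
        constructor
        · rintro ⟨h, h' | rfl⟩ <;> tauto
        · tauto
      have hcond' : (∃ v ∈ pre ++ [y], lb v = 0) ↔ ∃ v ∈ pre, lb v = 0 := by
        refine exists_congr fun v => ?_
        rw [and_comm, hcond, and_comm]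
      simp only [hcond, hcond']
      refine ⟨fun he => ?_, fun _ => ⟨by norm_num, by simp, by simp, by simp [hF.arr 3],
        by simpa using hF, by simp [h7], by simpa using h5, by simpa using h6, by simpa using h9⟩⟩
      simp [h3, hne] at he
  · rintro t st' ⟨hF, h7, h5, h6, h9⟩ ht
    simp only [hX] at h5 h6 h9
    refine hexit _ st' hF h7 h5 ?_ h9 (by omega)
    intro v
    rw [h6 v]
    congr 1
    simp only [Finset.mem_filter, Finset.mem_univ, true_and, eq_iff_iff]
    unfold relabel
    split_ifs with h <;> simp [h]

/-- Remove the vertices of the bag whose number is in register 5 from array 6. -/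
def unmarkBag : Program :=
  forList 2 3 5 22 23 24 (.store 6 24 3)

theorem does_unmarkBag {st : State} {Q : ℕ → State → Prop} {j : Fin k} {W : Finset (Fin n)}
    (hb : Base N st) (hB : Stored (st.arr 2) (st.arr 3) B) (hX : ∀ v, v ∈ B j ↔ v ∈ X j)
    (hj : st.reg 5 = j) (hW : Marks (st.arr 6) W)
    (hexit : ∀ t st', Frame 20 6 st st' → st'.arr 7 = st.arr 7 →
      Marks (st'.arr 6) (W.filter (· ∉ X j)) → t ≤ 4 * (B j).length + 5 → Q t st') :
    Does unmarkBag st Q := by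
  refine does_forList (v := j) (fun pre st' => Frame 20 6 st st' ∧ st'.arr 7 = st.arr 7 ∧
    Marks (st'.arr 6) (W.filter (· ∉ pre))) 1 hB hj
    (by norm_num) (by norm_num) (by norm_num) ?_ ?_ ?_
  · intro a b
    exact ⟨by simp [Frame.refl], by simp, by simpa using hW⟩
  · rintro pre y post st' a hpp ⟨hF, h7, h6⟩ -
    have h3 : st'.reg 3 = 0 := by rw [hF.reg 3 (by norm_num), hb.zero]
    rw [does_store]
    refine ⟨le_rfl, by simp, by simp, by simp [hF.arr 3], by simpa using hF, by simp [h7], ?_⟩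
    have hW' : W.filter (· ∉ pre ++ [y]) = (W.filter (· ∉ pre)).erase y := by
      ext v
      simp only [Finset.mem_filter, Finset.mem_erase, List.mem_append, List.mem_singleton]
      tauto
    rw [hW']
    simpa [h3] using h6.erase y
  · rintro t st' ⟨hF, h7, h6⟩ ht
    simp only [hX] at h6
    exact hexit t st' hF h7 h6 (by omega)

/-- Record the chains of the segment in array 6, whose label is in register 6: mark in array 7 the
vertices that are not sources.  This empties array 6. -/
def recordChains : Program :=
  forRange 21 0 <| .seq (.load 25 6 21) <| .seq
    (.ite (.eq 25 4)
      (.seq (.load 24 9 21) <| .seq (.load 23 5 24) <| .seq (.inc 23) <|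
        .ite (.lt 23 6) .skip (.ite (.eq 8 4) (.store 7 24 4) (.store 7 21 4)))
      .skip)
    (.store 6 21 3)

-- The loop clears array 6 behind itself, so that the next segment starts empty; hence the condition
-- `i ≤ w` in the invariant.
open Classical in
theorem does_recordChains {st : State} {Q : ℕ → State → Prop} {c : ℕ} {lb : Fin n → ℕ}
    {P : Finset (Fin n)} {f : Fin n → Fin n} {A : Fin n → Prop} (hb : Base N st)
    (hc : st.reg 6 = c) (hpar : st.reg 8 = c % 2) (hlb : ∀ v : Fin n, st.arr 5 v = lb v)
    (hP : Marks (st.arr 6) P) (hf : ∀ v ∈ P, st.arr 9 v = f v)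
    (hA : ∀ x : Fin n, st.arr 7 x = if A x then 1 else 0)
    (hexit : ∀ t st', Frame 20 6 st st' → Marks (n := n) (st'.arr 6) ∅ →
      (∀ x : Fin n, st'.arr 7 x = if A x ∨ ∃ v ∈ P, c ≤ lb (f v) + 1 ∧
        x = if c % 2 = 0 then v else f v then 1 else 0) → t ≤ 11 * n + 2 → Q t st') :
    Does recordChains st Q := by
  refine does_forRange (n := n) (fun i st' => Frame 20 6 st st' ∧ st'.arr 9 = st.arr 9 ∧
    (∀ w : Fin n, st'.arr 6 w = if w ∈ P ∧ i ≤ w then 1 else 0) ∧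
    ∀ x : Fin n, st'.arr 7 x = if A x ∨ ∃ v ∈ P, (v : ℕ) < i ∧ c ≤ lb (f v) + 1 ∧
      x = if c % 2 = 0 then v else f v then 1 else 0) (fun _ => 9) hb.size
    (by norm_num) ⟨by simp [Frame.refl], by simp, by simpa [Marks] using hP, by simpa using hA⟩ ?_ ?_
  · rintro v st' ⟨hF, h9, h6, h7⟩ h21 h0
    have r3 : st'.reg 3 = 0 := by rw [hF.reg 3 (by norm_num), hb.zero]
    have r4 : st'.reg 4 = 1 := by rw [hF.reg 4 (by norm_num), hb.one]
    have r6 : st'.reg 6 = c := by rw [hF.reg 6 (by norm_num), hc]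
    have r8 : st'.reg 8 = c % 2 := by rw [hF.reg 8 (by norm_num), hpar]
    have a5 : st'.arr 5 = st.arr 5 := hF.arr 5 (by norm_num)
    have hlt : ∀ w : Fin n, (w : ℕ) < v + 1 ↔ w = v ∨ (w : ℕ) < v := by
      intro w
      rw [Fin.ext_iff]
      omega
    have hge : ∀ w : Fin n, (v : ℕ) + 1 ≤ w ↔ w ≠ v ∧ (v : ℕ) ≤ w := by
      intro w
      rw [ne_eq, Fin.ext_iff]
      omega
    have hclear : ∀ w : Fin n, Function.update (st'.arr 6) v 0 w =
        if w ∈ P ∧ (v : ℕ) + 1 ≤ w then 1 else 0 := by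
      intro w
      by_cases hw : w = v
      · simp [hw]
      · rw [Function.update_of_ne (by simpa [Fin.ext_iff] using hw), h6 w]
        simp only [hge, ne_eq, hw, not_false_eq_true, true_and]
    have hset : ∀ y : Fin n, v ∈ P → c ≤ lb (f v) + 1 → (y = if c % 2 = 0 then v else f v) →
        ∀ x : Fin n, Function.update (st'.arr 7) y 1 x = if A x ∨ ∃ v_1 ∈ P,
          (v_1 : ℕ) < v + 1 ∧ c ≤ lb (f v_1) + 1 ∧ x = if c % 2 = 0 then v_1 else f v_1
          then 1 else 0 := by
      intro y hvP hle hy x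
      by_cases hx : x = y
      · rw [if_pos (Or.inr ⟨v, hvP, by omega, hle, hx.trans hy⟩), hx, Function.update_self]
      · rw [Function.update_of_ne (by simpa [Fin.ext_iff] using hx), h7 x]
        congr 1
        simp only [eq_iff_iff, hlt]
        refine or_congr_right (exists_congr fun w => ?_)
        constructor
        · tauto
        · rintro ⟨h1, rfl | h2, h3, h4⟩
          · exact absurd (h4.trans hy.symm) hx
          · exact ⟨h1, h2, h3, h4⟩
    have hkeep : ¬ (v ∈ P ∧ c ≤ lb (f v) + 1) →
        ∀ x : Fin n, st'.arr 7 x = if A x ∨ ∃ v_1 ∈ P,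
          (v_1 : ℕ) < v + 1 ∧ c ≤ lb (f v_1) + 1 ∧ x = if c % 2 = 0 then v_1 else f v_1
          then 1 else 0 := by
      intro hn x
      rw [h7 x]
      congr 1
      simp only [eq_iff_iff, hlt]
      refine or_congr_right (exists_congr fun w => ?_)
      constructor
      · tauto
      · rintro ⟨h1, rfl | h2, h3, h4⟩
        · exact absurd ⟨h1, h3⟩ hn
        · exact ⟨h1, h2, h3, h4⟩
    have hv6 := h6 v
    simp only [does_seq, does_load, does_ite, does_store, does_inc, does_skip, holds_eq, holds_lt]
    by_cases hvP : v ∈ P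
    · have hv9 : st'.arr 9 v = f v := by rw [h9, hf v hvP]
      simp only [reg_setReg, arr_setReg, reg_setArr, if_true, if_false, Nat.reduceEqDiff, h21, hv6,
        hv9, a5, hlb, r3, r4, r6, r8, h0, hvP, le_refl, and_self, true_implies, not_true_eq_false,
        false_implies, and_true]
      refine ⟨fun hlt' => ⟨by norm_num, by simp, by simp, by simpa using hF, by simpa using h9, by simpa using hclear,
        by simpa using hkeep (fun h => by omega)⟩, fun hle =>
        ⟨fun hodd => ⟨by norm_num, by simp, by simp, by simpa using hF, by simpa using h9, by simpa using hclear, ?_⟩,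
        fun heven => ⟨by norm_num, by simp, by simp, by simpa using hF, by simpa using h9, by simpa using hclear, ?_⟩⟩⟩
      · simpa using hset (f v) hvP (by omega) (by rw [if_neg (by omega)])
      · simpa using hset v hvP (by omega) (by rw [if_pos (by omega)])
    · simp only [reg_setReg, arr_setReg, reg_setArr, if_true, if_false, Nat.reduceEqDiff, h21, hv6,
        r3, r4, h0, hvP, false_and, zero_ne_one, not_false_eq_true, true_implies, false_implies,
        true_and]
      exact ⟨by norm_num, by simpa using hF, by simpa using h9, by simpa using hclear,
        by simpa using hkeep (fun h => hvP h.1)⟩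
  · rintro t st' ⟨hF, h9, h6, h7⟩ ht
    refine hexit t st' hF ?_ ?_ ?_
    · intro w
      rw [h6 w]
      simp
    · simpa using h7
    · simp at ht
      omega

/-- List the vertices that are not marked in array 7. -/
def output : Program :=
  forRange 21 0 <| .seq (.load 25 7 21) <| .ite (.eq 25 3) (.seq (.store 4 2 21) (.inc 2)) .skip

theorem does_output {st : State} {Q : ℕ → State → Prop} (hb : Base N st) (h2 : st.reg 2 = 0)
    (hexit : ∀ t st', Outputs st' (Finset.univ.filter fun v : Fin n => st.arr 7 v = 0) →
      t ≤ 6 * n + 2 → Q t st') :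
    Does output st Q := by
  refine does_forRange (n := n) (fun i st' => st'.reg 3 = 0 ∧ st'.arr 7 = st.arr 7 ∧
    ∃ l : List (Fin n), l.Nodup ∧ (∀ w : Fin n, w ∈ l ↔ (w : ℕ) < i ∧ st.arr 7 w = 0) ∧
      st'.reg 2 = l.length ∧ ∀ m (h : m < l.length), st'.arr 4 m = (l[m] : Fin n)) (fun _ => 4)
    hb.size (by norm_num) ⟨by simp [hb.zero], by simp, [], by simp [h2]⟩ ?_ ?_
  · rintro v st' ⟨h3, h7, l, hl, hmem, hlen, hget⟩ h21 h0
    have hlt : ∀ w : Fin n, (w : ℕ) < v + 1 ↔ (w : ℕ) < v ∨ w = v := by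
      intro w
      rw [Fin.ext_iff]
      omega
    simp only [does_seq, does_load, does_ite, does_store, does_inc, does_skip, holds_eq]
    simp only [reg_setReg, arr_setReg, reg_setArr, if_true, if_false, Nat.reduceEqDiff, h21, h7,
      h3, h0, hlen, true_and]
    refine ⟨fun hv => ⟨by norm_num, by simp [h7], l ++ [v], ?_, ?_, by simp, ?_⟩,
      fun hv => ⟨by norm_num, l, hl, ?_, rfl, hget⟩⟩
    · rw [List.nodup_append]
      refine ⟨hl, by simp, ?_⟩
      rintro a ha b hb' rfl
      obtain rfl := List.mem_singleton.1 hb'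
      exact absurd ((hmem a).1 ha).1 (lt_irrefl _)
    · intro w
      rw [List.mem_append, List.mem_singleton, hmem, hlt]
      constructor
      · rintro (h | rfl)
        · tauto
        · tauto
      · tauto
    · intro m hm
      by_cases hml : m < l.length
      · simpa [List.getElem_append_left hml, hml.ne] using hget m hml
      · have : m = l.length := by
          simp at hm
          omega
        subst this
        simp
    · intro w
      rw [hmem, hlt]
      constructor
      · tauto
      · rintro ⟨h | rfl, h'⟩
        · exact ⟨h, h'⟩
        · exact absurd h' hv
  · rintro t st' ⟨h3, h7, l, hl, hmem, hlen, hget⟩ ht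
    refine hexit t st' ⟨l, hl, ?_, hlen, ?_⟩ ?_
    · ext w
      simp [hmem]
    · rw [map_coe_eq]
      refine List.ext_getElem (by simp) fun m h1 h2 => ?_
      simpa using hget m (by simpa using h1)
    · simp at ht
      omega

end RAM

/-! ### The main loop and its amortised running time -/

namespace RAM

open ZeroForcing

variable {n k : ℕ} {N : Fin n → List (Fin n)} {B : Fin k → List (Fin n)} {G : SimpleGraph (Fin n)}
  {X : ℕ → Finset (Fin n)}

/-- The part of the memory that the main loop does not change. -/
structure Ready (N : Fin n → List (Fin n)) (B : Fin k → List (Fin n)) (st : State) : Prop where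
  base : Base N st
  count : st.reg 1 = k
  out : st.reg 2 = 0
  bags : Stored (st.arr 2) (st.arr 3) B

theorem Ready.of_frame {st st' : State} {r a : ℕ} (h : Ready N B st) (hf : Frame r a st st')
    (hr : 5 ≤ r) (ha : 4 ≤ a) : Ready N B st' where
  base := h.base.of_frame hf hr (by omega)
  count := by rw [hf.reg 1 (by omega), h.count]
  out := by rw [hf.reg 2 (by omega), h.out]
  bags := by
    rw [hf.arr 2 (by omega), hf.arr 3 (by omega)]
    exact h.bags

open Classical in
/-- The invariant of the main loop: the memory holds the state of the greedy segmentation. -/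
structure LoopInvariant (G : SimpleGraph (Fin n)) (X : ℕ → Finset (Fin n))
    (N : Fin n → List (Fin n)) (B : Fin k → List (Fin n)) (j s : ℕ) (lb : Fin n → ℕ) (b : ℕ → ℕ)
    (f : Fin n → Fin n) (τ : Fin n → ℕ) (st : State) : Prop where
  ready : Ready N B st
  bag : st.reg 5 = j
  label : st.reg 6 = s + 1
  parity : st.reg 8 = (s + 1) % 2
  labels : ∀ v : Fin n, st.arr 5 v = lb v
  current : Marks (st.arr 6) (Finset.univ.filter fun v => lb v = s + 1)
  chains : ∀ x : Fin n, st.arr 7 x = if NotSourceUpTo X s lb b f x then 1 else 0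
  progress : Progress G X j s lb b f τ

/-- A bound for the time that is spent on a bag with new vertices. -/
def testCost (N : Fin n → List (Fin n)) : ℕ :=
  58 * ∑ v, (N v).length + 127 * n + 40

/-- End the current segment at the bag whose number is in register 5. -/
def closeSegment : Program :=
  .seq unmarkBag <| .seq closure <| .seq recordChains <| .seq (.inc 6) <|
    .ite (.eq 8 4) (.copy 8 3) (.copy 8 4)

/-- Read a bag, and end the current segment at it if the segment contains a fort. -/
def processBag : Program :=
  .seq readBag <| .seq
    (.ite (.eq 9 4) (.seq closure (.ite (.eq 20 4) closeSegment .skip)) .skip) (.inc 5)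

/-- The forcing process is run again, now without the last bag, to obtain the forcers. The invariant
is asserted after one more increment of register 5, which `processBag` performs at its end. -/
theorem does_closeSegment {st : State} {Q : ℕ → State → Prop} {j : Fin k} {s : ℕ}
    {lb : Fin n → ℕ} {b : ℕ → ℕ} {f : Fin n → Fin n} {τ : Fin n → ℕ}
    (hN : ∀ v, Lists (N v) (G.neighborSet v)) (hX : IsPathSequence G X)
    (hB : ∀ v, v ∈ B j ↔ v ∈ X j) (hprog : Progress G X j s lb b f τ) (hready : Ready N B st)
    (hbag : st.reg 5 = j) (hlabel : st.reg 6 = s + 1) (hpar : st.reg 8 = (s + 1) % 2)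
    (hlb : ∀ v : Fin n, st.arr 5 v = relabel X j s lb v)
    (hW : Marks (st.arr 6) (Finset.univ.filter fun v => relabel X j s lb v = s + 1))
    (hchains : ∀ x : Fin n, st.arr 7 x = open Classical in
      if NotSourceUpTo X s lb b f x then 1 else 0)
    {F : Finset (Fin n)} (hF : IsFort G F) (hFlb : ∀ v ∈ F, relabel X j s lb v = s + 1)
    (hexit : ∀ t st' b' f' τ', LoopInvariant G X N B (j + 1) (s + 1) (relabel X j s lb) b' f' τ'
      (st'.setReg 5 (st'.reg 5 + 1)) →
      t ≤ 29 * ∑ v, (N v).length + 69 * n + 4 * (B j).length + 19 → Q t st') :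
    Does closeSegment st Q := by
  classical
  set P := Finset.univ.filter fun v => relabel X j s lb v = s + 1 ∧ v ∉ X j with hP
  rw [closeSegment, does_seq]
  refine does_unmarkBag hready.base hready.bags hB hbag hW fun t₁ st₁ hF₁ h7₁ h6₁ ht₁ => ?_
  have hr₁ := hready.of_frame hF₁ (by norm_num) (by norm_num)
  rw [Finset.filter_filter] at h6₁
  rw [does_seq]
  refine does_closure (P := P) hr₁.base hN h6₁ fun t₂ st₂ hF₂ hres ht₂ => ?_
  have hr₂ := hr₁.of_frame hF₂ (by norm_num) (by norm_num)
  obtain ⟨f₀, τ₀, hlast⟩ := hprog.last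
  have hsub := Progress.current_subset X j s lb
  -- A stuck process would exhibit a fort in a part of the segment as it was before this bag, which
  -- could be forced.
  obtain ⟨f', τ', hforces, h9⟩ : ∃ f τ, Forces G P f τ ∧ ∀ v ∈ P, st₂.arr 9 v = f v := by
    rcases hres with ⟨-, h⟩ | ⟨-, F', hF', hfort⟩
    · exact h
    · exact absurd hfort (hlast.not_isFort (hF'.trans hsub))
  rw [does_seq]
  refine does_recordChains (c := s + 1) (lb := relabel X j s lb) (P := P) (f := f')
    (A := NotSourceUpTo X s lb b f) hr₂.base ?_ ?_ ?_ ?_ h9 ?_ fun t₃ st₃ hF₃ h6₃ h7₃ ht₃ => ?_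
  · rw [hF₂.reg 6 (by norm_num), hF₁.reg 6 (by norm_num), hlabel]
  · rw [hF₂.reg 8 (by norm_num), hF₁.reg 8 (by norm_num), hpar]
  · rw [hF₂.arr 5 (by norm_num), hF₁.arr 5 (by norm_num)]
    exact hlb
  · rw [hF₂.arr 6 (by norm_num)]
    exact h6₁
  · rw [hF₂.arr 7 (by norm_num), h7₁]
    exact hchains
  have hF₁₃ : Frame 20 6 st st₃ := hF₁.trans ((hF₂.mono (by norm_num) (by norm_num)).trans hF₃)
  have hr₃ := hr₂.of_frame hF₃ (by norm_num) (by norm_num)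
  have hclose := hprog.close hP hF hFlb hforces
  have hemp : (Finset.univ.filter fun v => relabel X j s lb v = s + 1 + 1) = ∅ := by
    rw [Finset.filter_eq_empty_iff]
    intro v _
    have := hprog.le v
    unfold relabel
    split_ifs <;> omega
  have key : ∀ st' : State, Frame 5 8 st₃ st' → st'.reg 5 = j → st'.reg 6 = s + 2 →
      st'.reg 8 = (s + 2) % 2 → LoopInvariant G X N B (j + 1) (s + 1) (relabel X j s lb)
        (Function.update b (s + 1) j) (fun v => if v ∈ P then f' v else f v)
        (fun v => if v ∈ P then τ' v else τ v) (st'.setReg 5 (st'.reg 5 + 1)) := by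
    intro st' hF' h5 h6 h8
    refine ⟨(hr₃.of_frame hF' (by norm_num) (by norm_num)).of_frame
      (r := 5) (a := 8) (by simp [Frame.refl]) (by norm_num) (by norm_num), by simp [h5],
      by simp [h6], by simp [h8]; omega, ?_, ?_, ?_, hclose⟩
    · rw [arr_setReg, hF'.arr 5 (by norm_num), hF₁₃.arr 5 (by norm_num)]
      exact hlb
    · rw [arr_setReg, hF'.arr 6 (by norm_num), hemp]
      exact h6₃
    · intro x
      rw [arr_setReg, hF'.arr 7 (by norm_num), h7₃ x]
      simp only [hprog.notSourceUpTo_close hX hP f' x]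
  have e5 : st₃.reg 5 = j := by rw [hF₁₃.reg 5 (by norm_num), hbag]
  have e6 : st₃.reg 6 = s + 1 := by rw [hF₁₃.reg 6 (by norm_num), hlabel]
  have e8 : st₃.reg 8 = (s + 1) % 2 := by rw [hF₁₃.reg 8 (by norm_num), hpar]
  simp only [does_seq, does_inc, does_ite, does_copy, holds_eq]
  refine ⟨fun h => hexit _ _ _ _ _ (key _ ?_ ?_ ?_ ?_) (by omega),
    fun h => hexit _ _ _ _ _ (key _ ?_ ?_ ?_ ?_) (by omega)⟩
  · simp [Frame.refl]
  · simp [e5]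
  · simp [e6]
  · simp [hr₃.base.one, e8] at h
    simp [hr₃.base.zero]
    omega
  · simp [Frame.refl]
  · simp [e5]
  · simp [e6]
  · simp [hr₃.base.one, e8] at h
    simp [hr₃.base.one]
    omega

/-- The cost is amortised: a bag that triggers a test labels at least one new vertex, and `testCost`
is charged to it. Reading the bag and removing it from the segment take 8 and 4 steps per element.
-/
theorem does_processBag {st : State} {j : Fin k} {s : ℕ} {lb : Fin n → ℕ} {b : ℕ → ℕ}
    {f : Fin n → Fin n} {τ : Fin n → ℕ} (hN : ∀ v, Lists (N v) (G.neighborSet v))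
    (hX : IsPathSequence G X) (hB : ∀ v, v ∈ B j ↔ v ∈ X j)
    (h : LoopInvariant G X N B j s lb b f τ st) :
    Does processBag st fun t st' => ∃ s' lb' b' f' τ',
      LoopInvariant G X N B (j + 1) s' lb' b' f' τ' st' ∧
      t + testCost N * (Finset.univ.filter fun v => lb' v = 0).card ≤
        testCost N * (Finset.univ.filter fun v => lb v = 0).card + 12 * (B j).length + 9 := by
  classical
  rw [processBag, does_seq]
  refine does_readBag h.ready.base h.ready.bags hB h.bag h.label h.labels h.current
    fun t₁ st₁ hF₁ h7₁ h5₁ h6₁ h9₁ ht₁ => ?_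
  have hr₁ := h.ready.of_frame hF₁ (by norm_num) (by norm_num)
  have e5 : st₁.reg 5 = j := by rw [hF₁.reg 5 (by norm_num), h.bag]
  have e6 : st₁.reg 6 = s + 1 := by rw [hF₁.reg 6 (by norm_num), h.label]
  have e8 : st₁.reg 8 = (s + 1) % 2 := by rw [hF₁.reg 8 (by norm_num), h.parity]
  have hext : ∀ st' : State, Frame 9 8 st₁ st' →
      (∃ f τ, Forces G (Finset.univ.filter fun v => relabel X j s lb v = s + 1) f τ) →
      LoopInvariant G X N B (j + 1) s (relabel X j s lb) b f τ
        (st'.setReg 5 (st'.reg 5 + 1)) := by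
    intro st' hF' hlast
    refine ⟨(hr₁.of_frame hF' (by norm_num) (by norm_num)).of_frame
      (r := 5) (a := 8) (by simp [Frame.refl]) (by norm_num) (by norm_num),
      by simp [hF'.reg 5, e5], by simp [hF'.reg 6, e6], by simp [hF'.reg 8, e8], ?_, ?_, ?_,
      h.progress.extend hlast⟩
    · rw [arr_setReg, hF'.arr 5 (by norm_num)]
      exact h5₁
    · rw [arr_setReg, hF'.arr 6 (by norm_num)]
      exact h6₁
    · intro x
      rw [arr_setReg, hF'.arr 7 (by norm_num), h7₁, h.chains x]
      simp only [h.progress.notSourceUpTo_relabel hX x]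
  simp only [does_seq, does_inc, does_ite, does_skip, holds_eq]
  have hsub : (Finset.univ.filter fun v => relabel X j s lb v = 0) ⊆
      Finset.univ.filter fun v => lb v = 0 := by
    intro v hv
    simp only [Finset.mem_filter, Finset.mem_univ, true_and] at hv ⊢
    unfold relabel at hv
    split_ifs at hv
    exact hv
  by_cases hnew : ∃ v ∈ X j, lb v = 0
  · obtain ⟨v, hv, hv0⟩ := hnew
    have hcard : (Finset.univ.filter fun v => relabel X j s lb v = 0).card + 1 ≤
        (Finset.univ.filter fun v => lb v = 0).card := by
      refine Finset.card_lt_card (Finset.ssubset_iff_of_subset hsub |>.2 ⟨v, by simp [hv0], ?_⟩)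
      rw [Finset.mem_filter, relabel, if_pos ⟨hv0, hv⟩]
      simp
    have hmul := Nat.mul_le_mul_left (testCost N) hcard
    rw [mul_add, mul_one] at hmul
    -- This covers the test and a possible `closeSegment`: 58 = 29 + 29 and 127 = 58 + 69.
    have hcost : testCost N = 58 * ∑ v, (N v).length + 127 * n + 40 := rfl
    rw [if_pos ⟨v, hv, hv0⟩] at h9₁
    refine ⟨fun _ => ?_, fun hne => absurd (h9₁.trans hr₁.base.one.symm) hne⟩
    refine does_closure hr₁.base hN h6₁ fun t₂ st₂ hF₂ hres ht₂ => ?_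
    have hr₂ := hr₁.of_frame hF₂ (by norm_num) (by norm_num)
    rcases hres with ⟨h20, f', τ', hforces, -⟩ | ⟨h20, F, hF, hfort⟩
    · refine ⟨fun he => ?_, fun _ => ?_⟩
      · rw [h20, hr₂.base.one] at he
        exact absurd he zero_ne_one
      · exact ⟨_, _, _, _, _, hext st₂ (hF₂.mono (by norm_num) (by norm_num)) ⟨f', τ', hforces⟩,
          by omega⟩
    · refine ⟨fun _ => ?_, fun hne => absurd (h20.trans hr₂.base.one.symm) hne⟩
      refine does_closeSegment (s := s) (lb := lb) hN hX hB h.progress hr₂ ?_ ?_ ?_ ?_ ?_ ?_ hfort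
        (fun w hw => (Finset.mem_filter.1 (hF hw)).2) fun t₃ st₃ b' f' τ' hinv ht₃ => ?_
      · rw [hF₂.reg 5 (by norm_num), e5]
      · rw [hF₂.reg 6 (by norm_num), e6]
      · rw [hF₂.reg 8 (by norm_num), e8]
      · rw [hF₂.arr 5 (by norm_num)]
        exact h5₁
      · rw [hF₂.arr 6 (by norm_num)]
        exact h6₁
      · rw [hF₂.arr 7 (by norm_num), h7₁]
        exact h.chains
      · exact ⟨_, _, _, _, _, hinv, by omega⟩
  · rw [if_neg hnew] at h9₁
    refine ⟨fun he => ?_, fun _ => ⟨_, _, _, _, _, hext st₁ (Frame.refl _ _ _) ?_, ?_⟩⟩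
    · rw [h9₁, hr₁.base.one] at he
      exact absurd he zero_ne_one
    -- Without new vertices the segment is unchanged, so it still has no fort and needs no test.
    · have : relabel X j s lb = lb := by
        funext v
        rw [relabel, if_neg (fun h' => hnew ⟨v, h'.2, h'.1⟩)]
      rw [this]
      exact h.progress.last
    · have := Nat.mul_le_mul_left (testCost N) (Finset.card_le_card hsub)
      omega

/-- The approximation algorithm. -/
def approximate : Program :=
  .seq (.const 4 1) <| .seq (.const 6 1) <| .seq (.const 8 1) <|
    .seq (.loop (.lt 5 1) processBag) <| .seq closure <| .seq recordChains output

/-- The factor `n + 1` counts one charge for each vertex and one for the final segment, which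
contains no fort and is recorded in full, without removing a bag. -/
theorem does_approximate (hN : ∀ v, Lists (N v) (G.neighborSet v)) (hX : IsPathSequence G X)
    (hB : ∀ (j : Fin k) v, v ∈ B j ↔ v ∈ X j) (hall : ∀ v, ∃ j < k, v ∈ X j) {w : ℕ}
    (hw : ∀ i, (X i).card ≤ w) :
    Does approximate (input N B) fun t st => ∃ S : Finset (Fin n), Outputs st S ∧
      IsZeroForcingSet G S ∧ S.card ≤ w * zeroForcingNumber G ∧
      t ≤ testCost N * (n + 1) + ∑ j, (12 * (B j).length + 10) := by
  classical
  simp only [approximate, does_seq, does_const]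
  set d : ℕ → ℕ := fun j => if h : j < k then 12 * (B ⟨j, h⟩).length + 10 else 0 with hd
  have hsum : ∑ j, (12 * (B j).length + 10) = ∑ j ∈ Finset.Ico 0 k, d j := by
    rw [Nat.Ico_zero_eq_range, ← Fin.sum_univ_eq_sum_range]
    simp [hd]
  have hcost : testCost N = 58 * ∑ v, (N v).length + 127 * n + 40 := rfl
  refine does_loop (I := fun m st => ∃ j ≤ k, ∃ s lb b f τ, LoopInvariant G X N B j s lb b f τ st ∧
    m = testCost N * (Finset.univ.filter fun v => lb v = 0).card + ∑ i ∈ Finset.Ico j k, d i)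
    (m := testCost N * n + ∑ i ∈ Finset.Ico 0 k, d i) ?_ ?_ ?_
  · refine ⟨0, Nat.zero_le _, 0, fun _ => 0, fun _ => 0, id, fun _ => 0, ?_, by simp⟩
    refine ⟨⟨⟨by simp [input], by simp [input], by simp [input], ?_⟩, by simp [input],
      by simp [input], ?_⟩, by simp [input], by simp, by simp, by simp [input], ?_, ?_,
      Progress.zero _ _ _ _ _⟩
    · simpa [input] using stored_offsets_entries N
    · simpa [input] using stored_offsets_entries B
    · intro v
      simp [input]
    · intro x
      have : ¬ NotSourceUpTo X 0 (fun _ => 0) (fun _ => 0) id x := fun ⟨v, h0, _⟩ => h0 rfl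
      simp [input, this]
  · rintro m st ⟨j, hj, s, lb, b, f, τ, hinv, rfl⟩ hlt
    rw [holds_lt, hinv.bag, hinv.ready.count] at hlt
    refine (does_processBag (j := ⟨j, hlt⟩) hN hX (hB ⟨j, hlt⟩) hinv).mono ?_
    rintro t st' ⟨s', lb', b', f', τ', hinv', ht⟩
    refine ⟨_, ⟨j + 1, hlt, s', lb', b', f', τ', hinv', rfl⟩, ?_⟩
    rw [Finset.sum_eq_sum_Ico_succ_bot hlt]
    simp only [hd, dif_pos hlt]
    omega
  · rintro m st t ⟨j, hj, s, lb, b, f, τ, hinv, rfl⟩ hlt ht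
    rw [holds_lt, hinv.bag, hinv.ready.count] at hlt
    obtain rfl : j = k := by omega
    have hne : ∀ v, lb v ≠ 0 := fun v => (hinv.progress.seen v).2 (hall v)
    have hr := hinv.ready
    refine does_closure hr.base hN hinv.current fun t₁ st₁ hF₁ hres ht₁ => ?_
    have hr₁ := hr.of_frame hF₁ (by norm_num) (by norm_num)
    obtain ⟨f₀, τ₀, hlast⟩ := hinv.progress.last
    set P := Finset.univ.filter fun v => lb v = s + 1 with hP
    obtain ⟨f', τ', hforces, h9⟩ : ∃ f τ, Forces G P f τ ∧ ∀ v ∈ P, st₁.arr 9 v = f v := by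
      rcases hres with ⟨-, h⟩ | ⟨-, F', hF', hfort⟩
      · exact h
      · exact absurd hfort (hlast.not_isFort hF')
    refine does_recordChains (c := s + 1) (lb := lb) (P := P) (f := f')
      (A := NotSourceUpTo X s lb b f) hr₁.base ?_ ?_ ?_ ?_ h9 ?_ fun t₂ st₂ hF₂ h6₂ h7₂ ht₂ => ?_
    · rw [hF₁.reg 6 (by norm_num), hinv.label]
    · rw [hF₁.reg 8 (by norm_num), hinv.parity]
    · rw [hF₁.arr 5 (by norm_num)]
      exact hinv.labels
    · rw [hF₁.arr 6 (by norm_num)]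
      exact hinv.current
    · rw [hF₁.arr 7 (by norm_num)]
      exact hinv.chains
    have hr₂ := hr₁.of_frame hF₂ (by norm_num) (by norm_num)
    refine does_output hr₂.base hr₂.out fun t₃ st₃ hout ht₃ => ?_
    obtain ⟨hS1, hS2⟩ := hinv.progress.isZeroForcingSet_and_card_le hX hne hP hforces
      (S := Finset.univ.filter fun v : Fin n => st₂.arr 7 v = 0) (fun x => by
        rw [Finset.mem_filter, h7₂ x]
        simp) hw
    refine ⟨_, hout, hS1, hS2, ?_⟩
    rw [hsum, mul_add, mul_one]
    omega

end RAM

/-! ### The approximation theorem -/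

theorem mainTheorem11 :
    ∃ (P : RAM.Program) (C : ℕ),
      ∀ (n : ℕ) (G : SimpleGraph (Fin n)), G.Connected →
      ∀ (k : ℕ) (X : Fin k → Finset (Fin n)), ZeroForcing.IsPathDecomposition G X →
      ∀ (N : Fin n → List (Fin n)), (∀ v, RAM.Lists (N v) (G.neighborSet v)) →
      ∀ (B : Fin k → List (Fin n)), (∀ i, RAM.Lists (B i) (X i : Set (Fin n))) →
      ∃ (T : ℕ) (s : RAM.State) (S : Finset (Fin n)),
        RAM.Run P (RAM.input N B) T s ∧ RAM.Outputs s S ∧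
        ZeroForcing.IsZeroForcingSet G S ∧
        (S.card : ℤ) ≤ (ZeroForcing.width X + 1) * (ZeroForcing.zeroForcingNumber G : ℤ) ∧
        T ≤ C * (n * G.edgeSet.ncard + ∑ i, ((X i).card + 1)) ∧
        (2 ≤ n → k ≤ 4 * n → T ≤ C * (n * G.edgeSet.ncard)) := by
  -- The constant is generous. Bags beyond the `k` given ones are taken to be empty, which preserves
  -- the interval property.
  refine ⟨RAM.approximate, 10000, fun n G hG k X hX N hN B hB => ?_⟩
  set X' : ℕ → Finset (Fin n) := fun i => if h : i < k then X ⟨i, h⟩ else ∅ with hX'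
  have hXX' : ∀ i : Fin k, X' i = X i := fun i => dif_pos i.2
  have hmem : ∀ {i v}, v ∈ X' i → ∃ h : i < k, v ∈ X ⟨i, h⟩ := by
    intro i v hv
    by_cases h : i < k
    · exact ⟨h, hXX' ⟨i, h⟩ ▸ hv⟩
    · simp [hX', h] at hv
  have hseq : ZeroForcing.IsPathSequence G X' := by
    refine ⟨fun u v huv => ?_, fun v i s j his hsj hi hj => ?_⟩
    · obtain ⟨i, hu, hv⟩ := hX.edge_mem u v huv
      exact ⟨i, (hXX' i).symm ▸ hu, (hXX' i).symm ▸ hv⟩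
    · obtain ⟨hik, hi⟩ := hmem hi
      obtain ⟨hjk, hj⟩ := hmem hj
      have hs := hX.interval v ⟨i, hik⟩ ⟨s, by omega⟩ ⟨j, hjk⟩ his hsj hi hj
      exact (hXX' ⟨s, by omega⟩).symm ▸ hs
  have hBX : ∀ (j : Fin k) v, v ∈ B j ↔ v ∈ X' j := fun j v => by
    rw [(hB j).2, hXX', Finset.mem_coe]
  have hall : ∀ v, ∃ j < k, v ∈ X' j := fun v => by
    obtain ⟨i, hi⟩ := hX.vertex_mem v
    exact ⟨i, i.2, (hXX' i).symm ▸ hi⟩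
  have hw : ∀ i, (X' i).card ≤ Finset.univ.sup fun i => (X i).card := by
    intro i
    by_cases h : i < k
    · rw [hXX' ⟨i, h⟩]
      exact Finset.le_sup (f := fun i => (X i).card) (Finset.mem_univ _)
    · simp [hX', h]
  obtain ⟨T, s, hrun, S, hout, hS, hcard, hT⟩ := RAM.does_approximate hN hseq hBX hall hw
  have hlen : ∀ j, (B j).length = (X j).card := by
    intro j
    rw [← List.toFinset_card_of_nodup (hB j).1]
    congr 1
    ext v
    rw [List.mem_toFinset, (hB j).2, Finset.mem_coe]
  set m := G.edgeSet.ncard with hm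
  have hdeg : ∑ v, (N v).length = 2 * m := by
    classical
    rw [hm, Set.ncard_eq_toFinset_card', ← SimpleGraph.edgeFinset, ← G.sum_degrees_eq_twice_card_edges]
    refine Finset.sum_congr rfl fun v _ => ?_
    rw [← List.toFinset_card_of_nodup (hN v).1, SimpleGraph.degree]
    congr 1
    ext u
    rw [List.mem_toFinset, (hN v).2, SimpleGraph.mem_neighborFinset, SimpleGraph.mem_neighborSet]
  have hnm : n ≤ m + 1 := by
    have := hG.card_vert_le_card_edgeSet_add_one
    rwa [Nat.card_eq_fintype_card, Fintype.card_fin] at this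
  -- This absorbs the terms linear in `n` when `m = 0`, that is, for a single vertex.
  have hncov : n ≤ ∑ i, (X i).card := by
    have hsub : (Finset.univ : Finset (Fin n)) ⊆ Finset.univ.biUnion X := by
      intro v _
      obtain ⟨i, hi⟩ := hX.vertex_mem v
      exact Finset.mem_biUnion.2 ⟨i, Finset.mem_univ i, hi⟩
    calc n = (Finset.univ : Finset (Fin n)).card := by simp
      _ ≤ (Finset.univ.biUnion X).card := Finset.card_le_card hsub
      _ ≤ _ := Finset.card_biUnion_le
  have hn : 1 ≤ n := Fin.pos_iff_nonempty.2 hG.nonempty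
  simp only [hlen, RAM.testCost, hdeg] at hT
  simp only [Finset.sum_add_distrib, ← Finset.mul_sum, Finset.sum_const, Finset.card_univ,
    Fintype.card_fin, smul_eq_mul, mul_one] at hT ⊢
  refine ⟨T, s, S, hrun, hout, hS, ?_, ?_, fun h2 hk => ?_⟩
  · rw [ZeroForcing.width, sub_add_cancel]
    exact_mod_cast hcard
  · have h1 : m ≤ n * m := Nat.le_mul_of_pos_left m hn
    nlinarith
  · have hm1 : 1 ≤ m := by omega
    -- With at most `4n` bags the description has length `O(n²)`, and `n² ≤ n(m + 1) ≤ 2nm` as `m ≥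
    -- 1`.
    have hkn : ∑ i, (X i).card ≤ k * n := by
      have := Finset.sum_le_card_nsmul Finset.univ (fun i => (X i).card) n
        fun i _ => (Finset.card_le_univ _).trans (by simp)
      simpa using this
    have h1 : m ≤ n * m := Nat.le_mul_of_pos_left m hn
    have h3 : n ≤ n * m := Nat.le_mul_of_pos_right n hm1
    have h4 : k * n ≤ 4 * n * n := Nat.mul_le_mul_right n hk
    nlinarith
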